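/- Let $d,k,T$ be natural numbers with $T\ge 3$, and let $f_1,\dots,f_T$ be random continuously differentiable functions $\mathbb R^d\to\mathbb R$. Assume: (1) (Statistical sparsity) There is a function $\mathcal L:\mathbb R^d\to\mathbb R$ such that, for $1\le t\le T$ and $w\in\mathbb R^d$, $f_t(w)$ is integrable and $\mathbb E[f_t(w)\mid f_1,\dots,f_{t-1}]=\mathcal L(w)$ almost surely; and $\mathcal L$ has a minimizer $w^*$ with $\|w^*\|_1\le R$ and $\operatorname{supp}(w^*)=S$, where $|S|\le k$. Put $\mathcal H=\{w\in\mathbb R^d:\|w\|_1\le R,\ \operatorname{supp}(w)\subseteq S\}$. (2) (Strong convexity in expectation) $\alpha>0$ and $w\mapsto\mathcal L(w)-\frac{\alpha}{2}\sum_{i\in S}w_i^2$ is convex on $\mathbb R^d$. (3) (Bounded gradients) Almost surely, $\|\nabla f_t(w)\|_\infty\le B$ for all $w\in\mathcal H$ and $1\le t\le T$. (4) (Orthogonal noise features) For all $1\le t\le T$, $w\in\mathcal H$ and $i\notin S$, $\mathbb E[(\nabla f_t(w))_i\mid f_1,\dots,f_{t-1}]=0$ almost surely. Let $\delta>0$,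 $\lambda=\frac{3B}{2}\sqrt{\log\left(\frac{6d\log_2(2T)}{\delta}\right)}$ and $\eta=\alpha/2$, and define $\theta_t,w_t$ by $\theta_1=0$, $w_1=0$ and, for $t\ge1$, $$\theta_{t+1}=\theta_t-\left[\nabla f_t(w_t)-\eta w_t\right],\qquad w_{t+1}=\frac{1}{\eta t}\,S_{\lambda\sqrt{t+2}}(\theta_{t+1}),$$ where $S_c$ acts on each coordinate by $S_c(x)=0$ if $|x|<c$ and $S_c(x)=x-c\,\mathrm{sign}(x)$ otherwise. (This is streaming sparse regression with $\epsilon=0$.) Then there is a universal constant $C$ (not depending on the probability space, $d,k,T,R,B,\alpha,\delta$, the losses, $\mathcal L$, $w^*$ or $S$) such that, with probability at least $1-\delta$, the following holds: if $\|w_t\|_1\le R$ for all $1\le t\le T$, then $$\sum_{t=1}^T\left(f_t(w_t)-f_t(w^*)\right)\le C\,\frac{kB^2}{\alpha}\,\log\!\left(\frac{d\log T}{\delta}\right)\log T.$$ In particular, if the iterates almost surely satisfy $\|w_t\|_1\le R$ for $1\le t\le T$, then this regret bound holds with probability at least $1-\delta$. -/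

import Mathlib

open MeasureTheory

noncomputable section

namespace StreamingSparse

/-- Weight vectors in `ℝ^d`. -/
abbrev Vec (d : ℕ) := EuclideanSpace ℝ (Fin d)

/-- The `L₁` norm of a vector. -/
def l1Norm {d : ℕ} (w : Vec d) : ℝ := ∑ i, |w i|

/-- The soft-thresholding operator `S_c` on a single coordinate. -/
def softThreshold (c x : ℝ) : ℝ := if |x| < c then 0 else x - c * Real.sign x

/-- The sparsification step `θ_t ↦ w_t`, with threshold `lam * √(t + 1)`. For `t = 1` and `ε = 0`
the factor `1 / (ε + η (t - 1))` multiplies the zero vector, so that `w_1 = 0`. -/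
def sparsify {d : ℕ} (η lam ε : ℝ) (t : ℕ) (θ : Vec d) : Vec d :=
  (1 / (ε + η * ((t : ℝ) - 1))) •
    WithLp.toLp 2 (fun i => softThreshold (lam * √((t : ℝ) + 1)) (θ i))

/-- The vectors `θ_t` of streaming sparse regression on the losses `g 1, g 2, …`: `θ_1 = 0` and
`θ_{t+1} = θ_t - (∇ g_t(w_t) - η w_t)` for `t ≥ 1`. Index `0` is not used. -/
def theta {d : ℕ} (η lam ε : ℝ) (g : ℕ → Vec d → ℝ) : ℕ → Vec d
  | 0 => 0
  | 1 => 0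
  | (t + 2) =>
    theta η lam ε g (t + 1) -
      (gradient (g (t + 1)) (sparsify η lam ε (t + 1) (theta η lam ε g (t + 1))) -
        η • sparsify η lam ε (t + 1) (theta η lam ε g (t + 1)))

/-- The weights `w_t`, `t ≥ 1`, of streaming sparse regression on the losses `g 1, g 2, …`. -/
def weight {d : ℕ} (η lam ε : ℝ) (g : ℕ → Vec d → ℝ) (t : ℕ) : Vec d :=
  sparsify η lam ε t (theta η lam ε g t)

/-- `∑_{t=1}^T (g_t(w_t) - g_t(u))`. -/
def regret {d : ℕ} (g : ℕ → Vec d → ℝ) (w : ℕ → Vec d) (T : ℕ) (u : Vec d) : ℝ :=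
  ∑ t ∈ Finset.Icc 1 T, (g t (w t) - g t u)

/-- The candidate weight vectors `{w : ‖w‖₁ ≤ R, supp w ⊆ S}`. -/
def candidates {d : ℕ} (R : ℝ) (S : Finset (Fin d)) : Set (Vec d) :=
  {w | l1Norm w ≤ R ∧ ∀ i, i ∉ S → w i = 0}

/-- The σ-algebra generated by the random functions `f_1, …, f_{t-1}`. -/
abbrev past {Ω : Type*} {d : ℕ} (f : ℕ → Ω → Vec d → ℝ) (t : ℕ) : MeasurableSpace Ω :=
  ⨆ s ∈ Set.Ico 1 t, MeasurableSpace.comap (f s) MeasurableSpace.pi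

/-- `f_1, …, f_T` are random loss functions: `f_t(w)` is a random variable for each `w`, and each
realization of `f_t` is continuously differentiable on `ℝ^d`. -/
structure IsLossSequence {Ω : Type*} [MeasurableSpace Ω] {d : ℕ} (T : ℕ)
    (f : ℕ → Ω → Vec d → ℝ) : Prop where
  measurable : ∀ t ∈ Finset.Icc 1 T, ∀ w, Measurable (fun ω => f t ω w)
  contDiff : ∀ t ∈ Finset.Icc 1 T, ∀ ω, ContDiff ℝ 1 (f t ω)

/-- Statistical sparsity. -/
structure StatisticalSparsity {Ω : Type*} [MeasurableSpace Ω] (μ : Measure Ω) {d : ℕ} (T k : ℕ)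
    (f : ℕ → Ω → Vec d → ℝ) (L : Vec d → ℝ) (wstar : Vec d) (S : Finset (Fin d)) (R : ℝ) :
    Prop where
  integrable : ∀ t ∈ Finset.Icc 1 T, ∀ w, Integrable (fun ω => f t ω w) μ
  condExp_eq : ∀ t ∈ Finset.Icc 1 T, ∀ w,
    μ[fun ω => f t ω w | past f t] =ᵐ[μ] fun _ => L w
  minimizer : ∀ w, L wstar ≤ L w
  l1Norm_le : l1Norm wstar ≤ R
  support_eq : ∀ i, wstar i ≠ 0 ↔ i ∈ S
  card_le : S.card ≤ k

/-- Strong convexity in expectation: `L(w) - (α / 2) ‖w[S]‖₂²` is convex. -/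
def StrongConvexityInExpectation {d : ℕ} (L : Vec d → ℝ) (S : Finset (Fin d)) (α : ℝ) : Prop :=
  0 < α ∧ ConvexOn ℝ Set.univ (fun w : Vec d => L w - α / 2 * ∑ i ∈ S, (w i) ^ 2)

/-- Bounded gradients: almost surely, `‖∇ f_t(w)‖_∞ ≤ B` for all candidate vectors `w`. -/
def BoundedGradients {Ω : Type*} [MeasurableSpace Ω] (μ : Measure Ω) {d : ℕ} (T : ℕ)
    (f : ℕ → Ω → Vec d → ℝ) (S : Finset (Fin d)) (R B : ℝ) : Prop :=
  ∀ᵐ ω ∂μ, ∀ t ∈ Finset.Icc 1 T, ∀ w ∈ candidates R S, ∀ i, |gradient (f t ω) w i| ≤ B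

/-- Orthogonal noise features: given the past, the noise coordinates of the gradient have mean zero
at every candidate vector. -/
def OrthogonalNoise {Ω : Type*} [MeasurableSpace Ω] (μ : Measure Ω) {d : ℕ} (T : ℕ)
    (f : ℕ → Ω → Vec d → ℝ) (S : Finset (Fin d)) (R : ℝ) : Prop :=
  ∀ t ∈ Finset.Icc 1 T, ∀ w ∈ candidates R S, ∀ i, i ∉ S →
    μ[fun ω => gradient (f t ω) w i | past f t] =ᵐ[μ] fun _ => 0

/-- The regularization parameter `(3B/2) √(log (6 d log₂(2T) / δ))`. -/
def lamChoice (B : ℝ) (d T : ℕ) (δ : ℝ) : ℝ :=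
  3 * B / 2 * √(Real.log (6 * d * Real.logb 2 (2 * T) / δ))

end StreamingSparse

end

/-!
The regret splits into a linear part `∑ ⟪∇f_t(w_t), w_t - w*⟫` and the excess
`∑ (f_t(w_t) - f_t(w*) - ⟪∇f_t(w_t), w_t - w*⟫)` of the losses over their linearizations, and both
are compared with the squared distance `D = ∑ ‖w_t - w*‖²`, where `η = α / 2`.

* The algorithm is follow-the-regularized-leader, coordinate by coordinate, for the losses
  `⟪∇f_t(w_t), ·⟫ + η / 2 ‖· - w_t‖²` with the `L¹` penalty `λ √(t + 1)`. The increments of the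
  penalty are of order `λ / √t` and multiply `|w*_i| - |w_{t,i}| ≤ |w*_i - w_{t,i}|`, so Young's
  inequality trades them for a fraction of `D` and a term `λ² / (η t)`, which sums to `log T`. The
  linear part is thus at most `3 α / 8 * D` plus the claimed bound (`coordinate_regret_le`,
  `linear_regret_le`), provided that the iterates stay in the candidate set.
* Strong convexity of the expected loss gives the excess a conditional mean of at most
  `-α / 2 ‖w_t - w*‖²` (`setIntegral_linearizationExcess_le`), while its size is at most
  `2 B ‖w_t - w*‖₁ ≤ 2 B √k ‖w_t - w*‖₂`. The fluctuation is therefore controlled by the drift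
  itself: an exponential supermartingale bounds the excess by
  `-3 α / 8 * D + O(k B² / α log (1 / δ))` (`measure_excess_gt_le`), and the two multiples of `D`
  cancel.
* The iterates stay in the candidate set as long as the noise coordinates of the summed gradients
  stay below the soft-threshold level `λ √(t + 1)` (`weight_mem_candidates`). These sums are
  martingales with increments bounded by `B`; Ville's inequality along chords of the square root, on
  epochs of ratio four, shows that this holds with probability `1 - δ / 3`
  (`measure_exists_sqrt_lt_le`, `noise_failure_le`).

Conditioning on the past at the random vector `w_t` is reduced to fixed vectors: the bounds on
exponential moments are inequalities between integrals of nonnegative functions over events of the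
past, and they pass from constants to predictable vectors by simple functions and Fatou's lemma
(`setLIntegral_comp_le`).
-/

namespace StreamingSparse

/-! ### Regret of one coordinate of the algorithm -/

/-- The optimality conditions of soft-thresholding: `x - S_c(x)` is a subgradient of `c * |·|` at
`S_c(x)`. -/
lemma softThreshold_subgradient {c : ℝ} (hc : 0 ≤ c) (x : ℝ) :
    |x - softThreshold c x| ≤ c ∧
      (x - softThreshold c x) * softThreshold c x = c * |softThreshold c x| := by
  unfold softThreshold
  split_ifs with h
  · simpa using h.le
  · rw [not_lt] at h
    rcases lt_trichotomy x 0 with hx | rfl | hx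
    · rw [Real.sign_of_neg hx]
      rw [abs_of_neg hx] at h
      rw [abs_of_nonpos (by linarith : x - c * -1 ≤ 0)]
      exact ⟨by rw [abs_le]; constructor <;> linarith, by ring⟩
    · simp at h
      simp [hc]
    · rw [Real.sign_of_pos hx]
      rw [abs_of_pos hx] at h
      rw [abs_of_nonneg (by linarith : 0 ≤ x - c * 1)]
      exact ⟨by rw [abs_le]; constructor <;> linarith, by ring⟩

/-- A point satisfying the optimality conditions minimizes `v ↦ -θ v + a v² / 2 + c |v|`, with
quadratic growth around the minimizer. -/
lemma regularized_growth {a c θ w : ℝ} (h₁ : |θ - a * w| ≤ c) (h₂ : (θ - a * w) * w = c * |w|)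
    (v : ℝ) :
    -θ * w + a / 2 * w ^ 2 + c * |w| + a / 2 * (v - w) ^ 2 ≤
      -θ * v + a / 2 * v ^ 2 + c * |v| := by
  have h : (θ - a * w) * v ≤ c * |v| :=
    (le_abs_self _).trans (by rw [abs_mul]; gcongr)
  nlinarith

lemma neg_sq_div_le {a b x : ℝ} (ha : 0 < a) :
    -(b ^ 2 / (2 * a)) ≤ a / 2 * x ^ 2 - b * x := by
  have h : a / 2 * x ^ 2 - b * x + b ^ 2 / (2 * a) = (a * x - b) ^ 2 / (2 * a) := by
    field_simp
    ring
  have : 0 ≤ (a * x - b) ^ 2 / (2 * a) := by positivity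
  linarith

/-- The follow-the-regularized-leader inequality in one dimension, for the losses
`v ↦ g n * v + η / 2 * (v - w n) ^ 2` and the increasing `L¹` penalties `c n`. -/
lemma leader_regret_le {η B : ℝ} (hη : 0 < η) {θ w g c : ℕ → ℝ} (hc : Monotone c)
    (hθ0 : θ 0 = 0) (hw0 : w 0 = 0) (hθ : ∀ n, θ (n + 1) = θ n - (g n - η * w n))
    (hw₁ : ∀ n : ℕ, |θ n - η * n * w n| ≤ c n)
    (hw₂ : ∀ n : ℕ, (θ n - η * n * w n) * w n = c n * |w n|)
    {T : ℕ} (hg : ∀ n < T, |g n| ≤ B) (u : ℝ) :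
    ∑ n ∈ Finset.range T, (g n * w n + (c (n + 1) - c n) * |w n|
        - (B + (c (n + 1) - c n)) ^ 2 / (2 * (η * (n + 1)))) ≤
      ∑ n ∈ Finset.range T, (g n * u + η / 2 * (u - w n) ^ 2) + c T * |u| := by
  have key : ∀ N ≤ T, ∑ n ∈ Finset.range N, (g n * w n + (c (n + 1) - c n) * |w n|
        - (B + (c (n + 1) - c n)) ^ 2 / (2 * (η * (n + 1)))) ≤
      -θ N * w N + η * N / 2 * w N ^ 2 + c N * |w N| +
        η / 2 * ∑ n ∈ Finset.range N, w n ^ 2 := by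
    intro N
    induction N with
    | zero => simp [hθ0, hw0]
    | succ N ih =>
      intro hN
      have ih := ih (by omega)
      have grow := regularized_growth (hw₁ N) (hw₂ N) (w (N + 1))
      have hd : 0 ≤ c (N + 1) - c N := sub_nonneg.2 (hc (Nat.le_succ N))
      have habs : |w N| ≤ |w (N + 1)| + |w (N + 1) - w N| := by
        have := abs_sub_abs_le_abs_sub (w N) (w (N + 1))
        rw [abs_sub_comm] at this
        linarith
      have hgN : -(B * |w (N + 1) - w N|) ≤ g N * (w (N + 1) - w N) := by
        have h1 := neg_abs_le (g N * (w (N + 1) - w N))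
        rw [abs_mul] at h1
        have := mul_le_mul_of_nonneg_right (hg N (by omega)) (abs_nonneg (w (N + 1) - w N))
        linarith
      have hq := neg_sq_div_le (a := η * (N + 1)) (b := B + (c (N + 1) - c N))
        (x := |w (N + 1) - w N|) (by positivity)
      rw [sq_abs] at hq
      rw [Finset.sum_range_succ, Finset.sum_range_succ, hθ N]
      push_cast
      have h3 := mul_le_mul_of_nonneg_left habs hd
      nlinarith
  have grow := regularized_growth (hw₁ T) (hw₂ T) u
  have hθT : ∀ N, θ N = ∑ n ∈ Finset.range N, (η * w n - g n) := by
    intro N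
    induction N with
    | zero => simp [hθ0]
    | succ N ih => rw [Finset.sum_range_succ, ← ih, hθ]; ring
  have expand : ∑ n ∈ Finset.range T, (g n * u + η / 2 * (u - w n) ^ 2) =
      -θ T * u + η * T / 2 * u ^ 2 + η / 2 * ∑ n ∈ Finset.range T, w n ^ 2 := by
    have hsum : η * T / 2 * u ^ 2 = ∑ n ∈ Finset.range T, η / 2 * u ^ 2 := by
      rw [Finset.sum_const, Finset.card_range, nsmul_eq_mul]
      ring
    rw [hθT T, hsum, Finset.mul_sum, ← Finset.sum_neg_distrib, Finset.sum_mul,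
      ← Finset.sum_add_distrib, ← Finset.sum_add_distrib]
    refine Finset.sum_congr rfl fun n _ => ?_
    ring
  have := key T le_rfl
  have h0 : 0 ≤ η * T / 2 * (u - w T) ^ 2 := by positivity
  linarith

lemma one_lt_log_three : 1 < Real.log 3 := by
  rw [Real.lt_log_iff_exp_lt (by norm_num)]
  exact Real.exp_one_lt_three

lemma one_lt_log_natCast {T : ℕ} (hT : 3 ≤ T) : 1 < Real.log T :=
  one_lt_log_three.trans_le (Real.log_le_log (by norm_num) (by exact_mod_cast hT))

lemma sum_inv_le_two_mul_log {T : ℕ} (hT : 3 ≤ T) :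
    ∑ n ∈ Finset.range T, 1 / ((n : ℝ) + 1) ≤ 2 * Real.log T := by
  have h := harmonic_le_one_add_log T
  have h1 := (one_lt_log_natCast hT).le
  have h2 : ((harmonic T : ℚ) : ℝ) = ∑ n ∈ Finset.range T, 1 / ((n : ℝ) + 1) := by
    simp [harmonic]
  linarith

lemma sqrt_succ_sub_sqrt_sq_le (n : ℕ) :
    (√((n : ℝ) + 1 + 2) - √((n : ℝ) + 2)) ^ 2 ≤ 1 / (4 * (n + 1)) := by
  have h1 := Real.sq_sqrt (by positivity : (0 : ℝ) ≤ (n : ℝ) + 1 + 2)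
  have h2 := Real.sq_sqrt (by positivity : (0 : ℝ) ≤ (n : ℝ) + 2)
  have h3 : √((n : ℝ) + 2) ≤ √((n : ℝ) + 1 + 2) := Real.sqrt_le_sqrt (by linarith)
  have h4 := Real.sqrt_nonneg ((n : ℝ) + 2)
  set a := √((n : ℝ) + 1 + 2)
  set b := √((n : ℝ) + 2)
  rw [le_div_iff₀ (by positivity)]
  have h5 : (a - b) * (a + b) = 1 := by nlinarith
  have h6 : (a - b) * (2 * b) ≤ 1 := by nlinarith
  have h7 : ((a - b) * (2 * b)) ^ 2 ≤ 1 := by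
    apply pow_le_one₀ _ h6
    exact mul_nonneg (by linarith) (by linarith)
  nlinarith [sq_nonneg (a - b)]

/-- The linear regret of one coordinate is at most `3 η / 4` times the squared distance to the
comparator plus a logarithmic term. Since `w 0 = 0`, the penalty of the comparator `u` is a sum of
increments multiplying `|u| - |w n|`, plus an initial term multiplying `|u| = |u - w 0|`; both are
absorbed in the quadratic term. -/
lemma coordinate_regret_le {η lam B : ℝ} (hη : 0 < η) (hlam : 0 ≤ lam) {θ w g : ℕ → ℝ}
    (hθ0 : θ 0 = 0) (hw0 : w 0 = 0) (hθ : ∀ n, θ (n + 1) = θ n - (g n - η * w n))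
    (hw₁ : ∀ n : ℕ, |θ n - η * n * w n| ≤ lam * √((n : ℝ) + 2))
    (hw₂ : ∀ n : ℕ, (θ n - η * n * w n) * w n = lam * √((n : ℝ) + 2) * |w n|)
    {T : ℕ} (hT : 3 ≤ T) (hg : ∀ n < T, |g n| ≤ B) (u : ℝ) :
    ∑ n ∈ Finset.range T, g n * (w n - u) ≤
      3 / 4 * η * ∑ n ∈ Finset.range T, (w n - u) ^ 2 +
        (6 * lam ^ 2 + 2 * B ^ 2) / η * Real.log T := by
  set c : ℕ → ℝ := fun n => lam * √((n : ℝ) + 2) with hcdef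
  have hc : Monotone c := by
    intro m n hmn
    have : (m : ℝ) ≤ n := by exact_mod_cast hmn
    simp only [hcdef]
    gcongr
  have main := leader_regret_le hη hc hθ0 hw0 hθ hw₁ hw₂ hg u
  have hcT : c T = ∑ n ∈ Finset.range T, (c (n + 1) - c n) + c 0 := by
    rw [Finset.sum_range_sub]; ring
  have hc0 : c 0 * |u| ≤ η / 8 * u ^ 2 + 4 * lam ^ 2 / η := by
    have h2 : (c 0) ^ 2 = 2 * lam ^ 2 := by
      simp only [hcdef, mul_pow]
      rw [Real.sq_sqrt (by positivity)]
      push_cast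
      ring
    have h := neg_sq_div_le (a := η / 4) (b := c 0) (x := |u|) (by positivity)
    rw [h2, sq_abs] at h
    have : 2 * lam ^ 2 / (2 * (η / 4)) = 4 * lam ^ 2 / η := by field_simp
    linarith
  have hu : u ^ 2 ≤ ∑ n ∈ Finset.range T, (w n - u) ^ 2 := by
    have := Finset.single_le_sum (f := fun n => (w n - u) ^ 2) (s := Finset.range T)
      (fun n _ => sq_nonneg _) (Finset.mem_range.2 (by omega : 0 < T))
    simpa [hw0] using this
  have hterm : ∀ n ∈ Finset.range T,
      (c (n + 1) - c n) * |u| - (c (n + 1) - c n) * |w n|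
        + (B + (c (n + 1) - c n)) ^ 2 / (2 * (η * (n + 1))) ≤
      η / 8 * (w n - u) ^ 2 + (lam ^ 2 + B ^ 2) / η * (1 / ((n : ℝ) + 1)) := by
    intro n hn
    have hd : 0 ≤ c (n + 1) - c n := sub_nonneg.2 (hc (Nat.le_succ n))
    have hdsq : (c (n + 1) - c n) ^ 2 ≤ lam ^ 2 / (4 * (n + 1)) := by
      have := mul_le_mul_of_nonneg_left (sqrt_succ_sub_sqrt_sq_le n) (sq_nonneg lam)
      simp only [hcdef]
      push_cast
      calc _ = lam ^ 2 * (√((n : ℝ) + 1 + 2) - √((n : ℝ) + 2)) ^ 2 := by ring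
        _ ≤ _ := this
        _ = _ := by ring
    have hdsq' : (c (n + 1) - c n) ^ 2 ≤ lam ^ 2 / 4 := by
      refine hdsq.trans ?_
      apply div_le_div_of_nonneg_left (sq_nonneg _) (by norm_num)
      have : (0 : ℝ) ≤ n := by positivity
      linarith
    have habs : |u| ≤ |w n| + |w n - u| := by
      have := abs_sub_abs_le_abs_sub u (w n)
      rw [abs_sub_comm] at this
      linarith
    have h1 := mul_le_mul_of_nonneg_left habs hd
    have h2 := neg_sq_div_le (a := η / 4) (b := c (n + 1) - c n) (x := |w n - u|)
      (by positivity)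
    rw [sq_abs] at h2
    have h3 : (c (n + 1) - c n) ^ 2 / (2 * (η / 4)) ≤ lam ^ 2 / (2 * η * (n + 1)) := by
      calc _ ≤ lam ^ 2 / (4 * (n + 1)) / (2 * (η / 4)) := by gcongr
        _ = _ := by field_simp
    have h4 : (B + (c (n + 1) - c n)) ^ 2 / (2 * (η * (n + 1))) ≤
        (2 * B ^ 2 + lam ^ 2 / 2) / (2 * (η * (n + 1))) := by
      gcongr
      nlinarith [sq_nonneg (B - (c (n + 1) - c n))]
    have h5 : lam ^ 2 / (2 * η * (n + 1)) + (2 * B ^ 2 + lam ^ 2 / 2) / (2 * (η * (n + 1))) ≤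
        (lam ^ 2 + B ^ 2) / η * (1 / ((n : ℝ) + 1)) := by
      have : (lam ^ 2 + B ^ 2) / η * (1 / ((n : ℝ) + 1)) =
        lam ^ 2 / (2 * η * (n + 1)) + (2 * B ^ 2 + lam ^ 2) / (2 * (η * (n + 1))) := by
        field_simp; ring
      rw [this]
      gcongr
      nlinarith [sq_nonneg lam]
    linarith
  have hsum := Finset.sum_le_sum hterm
  simp only [Finset.sum_add_distrib, Finset.sum_sub_distrib, ← Finset.mul_sum,
    ← Finset.sum_mul] at hsum main hcT ⊢
  have hlog := (one_lt_log_natCast hT).le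
  have hsplit : ∑ n ∈ Finset.range T, g n * (w n - u) =
      ∑ n ∈ Finset.range T, g n * w n - (∑ n ∈ Finset.range T, g n) * u := by
    rw [Finset.sum_mul, ← Finset.sum_sub_distrib]
    exact Finset.sum_congr rfl fun n _ => by ring
  have hsym : ∑ n ∈ Finset.range T, (u - w n) ^ 2 = ∑ n ∈ Finset.range T, (w n - u) ^ 2 :=
    Finset.sum_congr rfl fun n _ => by ring
  have hharm := mul_le_mul_of_nonneg_left (sum_inv_le_two_mul_log hT)
    (by positivity : 0 ≤ (lam ^ 2 + B ^ 2) / η)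
  have hlam4 : 4 * lam ^ 2 / η ≤ 4 * lam ^ 2 / η * Real.log T :=
    le_mul_of_one_le_right (by positivity) hlog
  have hfin : (6 * lam ^ 2 + 2 * B ^ 2) / η * Real.log T =
      4 * lam ^ 2 / η * Real.log T + (lam ^ 2 + B ^ 2) / η * (2 * Real.log T) := by
    field_simp; ring
  have hu' := mul_le_mul_of_nonneg_left hu (by positivity : 0 ≤ η / 8)
  have hcu : c T * |u| = (∑ n ∈ Finset.range T, c (n + 1) - ∑ n ∈ Finset.range T, c n) * |u|
      + c 0 * |u| := by rw [hcT]; ring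
  rw [hsym] at main
  rw [hsplit, hfin]
  linarith

/-! ### Exponential supermartingales -/

section Probability

open scoped ENNReal
open Filter Topology

variable {Ω : Type*}

/-- Hoeffding's lemma on an event: a variable with `|X| ≤ c` whose mean on `A` is at most `m` has
a sub-Gaussian exponential moment on `A`. -/
lemma setLIntegral_exp_le [MeasurableSpace Ω] {μ : Measure Ω} [IsProbabilityMeasure μ]
    {X : Ω → ℝ} {A : Set Ω} {c m s : ℝ} (hX : Measurable X) (hc : ∀ᵐ ω ∂μ, |X ω| ≤ c) (hs : 0 ≤ s)
    (hm : ∫ ω in A, X ω ∂μ ≤ m * μ.real A) :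
    ∫⁻ ω in A, ENNReal.ofReal (Real.exp (s * X ω - s * m - s ^ 2 * c ^ 2 / 2)) ∂μ ≤ μ A := by
  by_cases h0 : μ A = 0
  · rw [setLIntegral_measure_zero _ _ h0]
    exact zero_le
  have hprob : IsProbabilityMeasure (ProbabilityTheory.cond μ A) :=
    ProbabilityTheory.cond_isProbabilityMeasure h0
  have hpos : 0 < μ.real A := by
    rw [measureReal_def]
    exact ENNReal.toReal_pos h0 (measure_ne_top _ _)
  have hb : ∀ᵐ ω ∂(ProbabilityTheory.cond μ A), X ω ∈ Set.Icc (-c) c := by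
    have hac : ProbabilityTheory.cond μ A ≪ μ := ProbabilityTheory.cond_absolutelyContinuous
    filter_upwards [hac.ae_le hc] with ω hω
    exact abs_le.1 hω
  set ν := ProbabilityTheory.cond μ A with hν
  have hmgf : ∫ ω, Real.exp (s * (X ω - ∫ x, X x ∂ν)) ∂ν ≤ Real.exp (c ^ 2 * s ^ 2 / 2) := by
    refine ((ProbabilityTheory.hasSubgaussianMGF_of_mem_Icc hX.aemeasurable hb).mgf_le s).trans
      (le_of_eq ?_)
    have : |c + c| / 2 = |c| := by
      rw [← two_mul, abs_mul, abs_two]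
      ring
    simp [this]
  have hint : Integrable (fun ω => Real.exp (s * (X ω - ∫ x, X x ∂ν))) ν :=
    (ProbabilityTheory.hasSubgaussianMGF_of_mem_Icc hX.aemeasurable hb).integrable_exp_mul s
  have hmean : ∫ x, X x ∂ν ≤ m := by
    rw [hν, ProbabilityTheory.cond, integral_smul_measure, ENNReal.toReal_inv, smul_eq_mul,
      ← measureReal_def, inv_mul_le_iff₀ hpos, mul_comm]
    exact hm
  have hone : ∫⁻ ω, ENNReal.ofReal (Real.exp (s * X ω - s * m - s ^ 2 * c ^ 2 / 2)) ∂ν ≤ 1 := by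
    calc ∫⁻ ω, ENNReal.ofReal (Real.exp (s * X ω - s * m - s ^ 2 * c ^ 2 / 2)) ∂ν
        ≤ ∫⁻ ω, ENNReal.ofReal (Real.exp (s * (X ω - ∫ x, X x ∂ν)) *
            Real.exp (-(c ^ 2 * s ^ 2 / 2))) ∂ν := by
          refine lintegral_mono fun ω => ENNReal.ofReal_le_ofReal ?_
          rw [← Real.exp_add]
          refine Real.exp_le_exp.2 ?_
          have := mul_le_mul_of_nonneg_left hmean hs
          linarith
      _ = ENNReal.ofReal (∫ ω, Real.exp (s * (X ω - ∫ x, X x ∂ν)) *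
            Real.exp (-(c ^ 2 * s ^ 2 / 2)) ∂ν) :=
          (ofReal_integral_eq_lintegral_ofReal (hint.mul_const _)
            (Filter.Eventually.of_forall fun ω => by positivity)).symm
      _ ≤ 1 := by
          rw [integral_mul_const, ENNReal.ofReal_le_one]
          calc _ ≤ Real.exp (c ^ 2 * s ^ 2 / 2) * Real.exp (-(c ^ 2 * s ^ 2 / 2)) := by gcongr
            _ = 1 := by rw [← Real.exp_add, add_neg_cancel, Real.exp_zero]
  rw [hν, ProbabilityTheory.cond, lintegral_smul_measure, smul_eq_mul,
    ENNReal.inv_mul_le_iff h0 (measure_ne_top _ _), mul_one] at hone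
  exact hone

/-- A bound on exponential moments that holds at each fixed point of `H` also holds at a random
point of `H` which is measurable with respect to the past `m`. -/
lemma setLIntegral_comp_le {E : Type*} [MetricSpace E] [MeasurableSpace E] [BorelSpace E]
    [SecondCountableTopology E] {m : MeasurableSpace Ω} [mΩ : MeasurableSpace Ω] {μ : Measure Ω}
    (hm : m ≤ mΩ) {h : Ω → E → ℝ≥0∞}
    {H : Set E} (hcont : ∀ ω, Continuous (h ω)) (hmeas : ∀ w, Measurable fun ω => h ω w)
    (hle : ∀ w ∈ H, ∀ A, MeasurableSet[m] A → ∫⁻ ω in A, h ω w ∂μ ≤ μ A)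
    {W : Ω → E} (hW : Measurable[m] W) (hWH : ∀ ω, W ω ∈ H) {A : Set Ω}
    (hA : MeasurableSet[m] A) : ∫⁻ ω in A, h ω (W ω) ∂μ ≤ μ A := by
  rcases isEmpty_or_nonempty Ω with hΩ | ⟨⟨ω₀⟩⟩
  · simp [μ.eq_zero_of_isEmpty]
  let V : ℕ → @SimpleFunc Ω m E := fun n =>
    @SimpleFunc.approxOn E Ω _ _ _ m W hW H (W ω₀) (hWH ω₀) _ n
  have hVH : ∀ n ω, V n ω ∈ H := fun n ω =>
    @SimpleFunc.approxOn_mem E Ω _ _ _ m _ hW _ _ (hWH ω₀) _ n ω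
  have hlim : ∀ ω, Tendsto (fun n => V n ω) atTop (𝓝 (W ω)) := fun ω =>
    @SimpleFunc.tendsto_approxOn E Ω _ _ _ m _ hW _ _ (hWH ω₀) _ ω (subset_closure (hWH ω))
  have hVmeas : ∀ n, Measurable fun ω => h ω (V n ω) := by
    intro n
    have h1 : Measurable (Function.uncurry fun w ω => h ω w) :=
      measurable_uncurry_of_continuous_of_measurable hcont hmeas
    have h2 : Measurable (V n) := (@SimpleFunc.measurable Ω E m _ (V n)).mono hm le_rfl
    exact h1.comp (h2.prodMk measurable_id)
  have hV : ∀ n, ∫⁻ ω in A, h ω (V n ω) ∂μ ≤ μ A := by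
    intro n
    have hset : ∀ v, MeasurableSet[m] (A ∩ V n ⁻¹' {v}) := fun v =>
      hA.inter (@SimpleFunc.measurableSet_fiber Ω E m (V n) v)
    have hU : A = ⋃ v ∈ (@SimpleFunc.range Ω E m (V n)), A ∩ V n ⁻¹' {v} := by
      ext ω
      simp
    have hd : Set.PairwiseDisjoint (↑(@SimpleFunc.range Ω E m (V n)))
        fun v => A ∩ V n ⁻¹' {v} := by
      intro v _ v' _ hvv
      refine Set.disjoint_left.2 fun ω h1 h2 => hvv ?_
      exact (h1.2 : V n ω = v).symm.trans h2.2
    conv_lhs => rw [hU]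
    rw [lintegral_biUnion_finset hd fun v _ => hm _ (hset v)]
    conv_rhs => rw [hU]
    rw [measure_biUnion_finset hd fun v _ => hm _ (hset v)]
    refine Finset.sum_le_sum fun v hv => ?_
    rw [setLIntegral_congr_fun (g := fun ω => h ω v) (hm _ (hset v))
      (fun ω hω => congrArg (h ω) (hω.2 : V n ω = v))]
    obtain ⟨ω, rfl⟩ := (@SimpleFunc.mem_range Ω E m (V n) v).1 hv
    exact hle _ (hVH n ω) _ (hset _)
  calc ∫⁻ ω in A, h ω (W ω) ∂μ
      = ∫⁻ ω in A, liminf (fun n => h ω (V n ω)) atTop ∂μ := by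
        refine lintegral_congr fun ω => ?_
        exact (((hcont ω).tendsto _).comp (hlim ω)).liminf_eq.symm
    _ ≤ liminf (fun n => ∫⁻ ω in A, h ω (V n ω) ∂μ) atTop := lintegral_liminf_le hVmeas
    _ ≤ μ A := by
        refine liminf_le_of_le (by isBoundedDefault) fun b hb => ?_
        obtain ⟨n, hn⟩ := hb.exists
        exact hn.trans (hV n)

/-- If `h` has conditional mean at most one given `m`, then multiplying an `m`-measurable
variable by `h` does not increase its integral. -/
lemma lintegral_mul_le_of_forall_setLIntegral_le {m : MeasurableSpace Ω}
    [mΩ : MeasurableSpace Ω] {μ : Measure Ω} (hm : m ≤ mΩ) {h Z : Ω → ℝ≥0∞}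
    (hh : Measurable h) (hZ : Measurable[m] Z)
    (hle : ∀ A, MeasurableSet[m] A → ∫⁻ ω in A, h ω ∂μ ≤ μ A) :
    ∫⁻ ω, Z ω * h ω ∂μ ≤ ∫⁻ ω, Z ω ∂μ := by
  have htrim : (μ.withDensity h).trim hm ≤ μ.trim hm := by
    refine Measure.le_iff.2 fun A hA => ?_
    rw [trim_measurableSet_eq hm hA, trim_measurableSet_eq hm hA, withDensity_apply _ (hm _ hA)]
    exact hle A hA
  calc ∫⁻ ω, Z ω * h ω ∂μ = ∫⁻ ω, Z ω ∂(μ.withDensity h) := by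
        rw [lintegral_withDensity_eq_lintegral_mul _ hh (hZ.mono hm le_rfl)]
        simp only [Pi.mul_apply, mul_comm]
    _ = ∫⁻ ω, Z ω ∂((μ.withDensity h).trim hm) := (lintegral_trim hm hZ).symm
    _ ≤ ∫⁻ ω, Z ω ∂(μ.trim hm) := lintegral_mono' htrim le_rfl
    _ = ∫⁻ ω, Z ω ∂μ := lintegral_trim hm hZ

/-- Ville's inequality for products of nonnegative factors with conditional mean at most one. -/
lemma measure_exists_le_prod_le [mΩ : MeasurableSpace Ω] {μ : Measure Ω} [IsProbabilityMeasure μ]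
    {T : ℕ} {m : ℕ → MeasurableSpace Ω}
    (hmono : Monotone m) (hm : ∀ n ≤ T, m n ≤ mΩ) {h : ℕ → Ω → ℝ≥0∞}
    (hmeas : ∀ n < T, Measurable[m (n + 1)] (h n))
    (hle : ∀ n < T, ∀ A, MeasurableSet[m n] A → ∫⁻ ω in A, h n ω ∂μ ≤ μ A)
    {c : ℝ≥0∞} (hc : c ≠ 0) (hc' : c ≠ ∞) :
    μ {ω | ∃ n ≤ T, c ≤ ∏ j ∈ Finset.range n, h j ω} ≤ c⁻¹ := by
  classical
  -- The product stopped when it first reaches `c`.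
  let Y : ℕ → Ω → ℝ≥0∞ := fun n => Nat.rec (motive := fun _ => Ω → ℝ≥0∞) (fun _ => 1)
    (fun j y ω => y ω * (if c ≤ y ω then 1 else h j ω)) n
  have hY0 : ∀ ω, Y 0 ω = 1 := fun ω => rfl
  have hYs : ∀ n ω, Y (n + 1) ω = Y n ω * (if c ≤ Y n ω then 1 else h n ω) := fun n ω => rfl
  have hYm : ∀ n ≤ T, Measurable[m n] (Y n) := by
    intro n
    induction n with
    | zero => intro _; exact @measurable_const _ _ _ (m 0) 1
    | succ n ih =>
      intro hn
      have ih' := (ih (by omega)).mono (hmono (Nat.le_succ n)) le_rfl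
      have h1 : Measurable[m (n + 1)] fun ω => if c ≤ Y n ω then 1 else h n ω :=
        Measurable.ite (measurableSet_le measurable_const ih') measurable_const
          (hmeas n (by omega))
      exact ih'.mul h1
  have hYint : ∀ n ≤ T, ∫⁻ ω, Y n ω ∂μ ≤ 1 := by
    intro n
    induction n with
    | zero => intro _; simp [hY0]
    | succ n ih =>
      intro hn
      refine le_trans ?_ (ih (by omega))
      simp only [hYs]
      have hYn := hYm n (by omega)
      have hS : MeasurableSet[m n] {ω | c ≤ Y n ω} := measurableSet_le measurable_const hYn
      have hhn := (hmeas n (by omega)).mono (hm (n + 1) hn) le_rfl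
      refine lintegral_mul_le_of_forall_setLIntegral_le (hm n (by omega)) ?_ hYn ?_
      · exact Measurable.ite (hm n (by omega) _ hS) measurable_const hhn
      · intro A hA
        have hS' := hm n (by omega) _ hS
        rw [← lintegral_inter_add_sdiff _ A hS', ← measure_inter_add_sdiff A hS']
        refine add_le_add ?_ ?_
        · rw [setLIntegral_congr_fun (f := fun ω => if c ≤ Y n ω then 1 else h n ω)
            (g := fun _ => 1) ((hm n (by omega) _ hA).inter hS')
            (fun ω hω => if_pos hω.2)]
          simp
        · rw [setLIntegral_congr_fun (f := fun ω => if c ≤ Y n ω then 1 else h n ω) (g := h n)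
            ((hm n (by omega) _ hA).diff hS')
            (fun ω hω => if_neg hω.2)]
          exact hle n (by omega) _ (hA.diff hS)
  have hcross : ∀ n ω, (c ≤ Y n ω ∨ Y n ω = ∏ j ∈ Finset.range n, h j ω) ∧
      ((∃ j ≤ n, c ≤ ∏ i ∈ Finset.range j, h i ω) → c ≤ Y n ω) := by
    intro n ω
    induction n with
    | zero => simp [hY0]
    | succ n ih =>
      by_cases hY : c ≤ Y n ω
      · have : Y (n + 1) ω = Y n ω := by rw [hYs, if_pos hY, mul_one]
        rw [this]
        exact ⟨Or.inl hY, fun _ => hY⟩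
      · have h1 := ih.1.resolve_left hY
        have h2 : Y (n + 1) ω = ∏ j ∈ Finset.range (n + 1), h j ω := by
          rw [hYs, if_neg hY, h1, Finset.prod_range_succ]
        refine ⟨Or.inr h2, ?_⟩
        rintro ⟨j, hj, hcj⟩
        rcases Nat.le_succ_iff.1 hj with hj | rfl
        · exact absurd (ih.2 ⟨j, hj, hcj⟩) hY
        · rwa [h2]
  calc μ {ω | ∃ n ≤ T, c ≤ ∏ j ∈ Finset.range n, h j ω} ≤ μ {ω | c ≤ Y T ω} :=
        measure_mono fun ω hω => (hcross T ω).2 hω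
    _ ≤ (∫⁻ ω, Y T ω ∂μ) / c :=
        meas_ge_le_lintegral_div ((hYm T le_rfl).mono (hm T le_rfl) le_rfl).aemeasurable hc hc'
    _ ≤ 1 / c := by gcongr; exact hYint T le_rfl
    _ = c⁻¹ := one_div c

end Probability

/-! ### Gradients and candidate vectors -/

open Filter Topology

lemma fderiv_apply_eq_sum {d : ℕ} (F : Vec d → ℝ) (w v : Vec d) :
    fderiv ℝ F w v = ∑ i, gradient F w i * v i := by
  rw [← inner_gradient_left, PiLp.inner_apply]
  simp [mul_comm]

lemma gradient_apply_eq_fderiv {d : ℕ} (F : Vec d → ℝ) (w : Vec d) (i : Fin d) :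
    gradient F w i = fderiv ℝ F w (EuclideanSpace.single i 1) := by
  rw [fderiv_apply_eq_sum]
  simp

lemma continuous_gradient_apply {d : ℕ} {F : Vec d → ℝ} (hF : ContDiff ℝ 1 F) (i : Fin d) :
    Continuous fun w => gradient F w i := by
  simp only [gradient_apply_eq_fderiv]
  exact (hF.continuous_fderiv one_ne_zero).clm_apply continuous_const

lemma measurable_gradient_apply {Ω : Type*} [MeasurableSpace Ω] {d : ℕ} {F : Ω → Vec d → ℝ}
    (hF : ∀ w, Measurable fun ω => F ω w) (hd : ∀ ω, Differentiable ℝ (F ω)) (w : Vec d)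
    (i : Fin d) : Measurable fun ω => gradient (F ω) w i := by
  simp only [gradient_apply_eq_fderiv]
  refine measurable_of_tendsto_metrizable (f := fun (n : ℕ) ω =>
    (n : ℝ) • (F ω (w + (n : ℝ)⁻¹ • EuclideanSpace.single i 1) - F ω w))
    (fun n => ((hF _).fun_sub (hF w)).fun_const_smul _) ?_
  refine tendsto_pi_nhds.2 fun ω => ?_
  refine ((hd ω) w).hasFDerivAt.lim _ ?_
  simpa using tendsto_natCast_atTop_atTop (R := ℝ)

lemma measurable_gradient_comp_apply {Ω : Type*} [MeasurableSpace Ω] {d : ℕ} {F : Ω → Vec d → ℝ}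
    (hF : ∀ w, Measurable fun ω => F ω w) (hd : ∀ ω, ContDiff ℝ 1 (F ω)) {W : Ω → Vec d}
    (hW : Measurable W) (i : Fin d) : Measurable fun ω => gradient (F ω) (W ω) i := by
  have h : Measurable (Function.uncurry fun w ω => gradient (F ω) w i) :=
    measurable_uncurry_of_continuous_of_measurable (fun ω => continuous_gradient_apply (hd ω) i)
      fun w => measurable_gradient_apply hF (fun ω => (hd ω).differentiable one_ne_zero) w i
  exact h.comp (hW.prodMk measurable_id)

lemma measurable_gradient_comp {Ω : Type*} [MeasurableSpace Ω] {d : ℕ} {F : Ω → Vec d → ℝ}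
    (hF : ∀ w, Measurable fun ω => F ω w) (hd : ∀ ω, ContDiff ℝ 1 (F ω)) {W : Ω → Vec d}
    (hW : Measurable W) : Measurable fun ω => gradient (F ω) (W ω) :=
  (WithLp.measurable_toLp 2 (Fin d → ℝ)).comp
    (measurable_pi_iff.2 fun i => measurable_gradient_comp_apply hF hd hW i)

lemma measurable_eval_comp {Ω : Type*} [MeasurableSpace Ω] {d : ℕ} {F : Ω → Vec d → ℝ}
    (hF : ∀ w, Measurable fun ω => F ω w) (hd : ∀ ω, ContDiff ℝ 1 (F ω)) {W : Ω → Vec d}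
    (hW : Measurable W) : Measurable fun ω => F ω (W ω) := by
  have h : Measurable (Function.uncurry fun w ω => F ω w) :=
    measurable_uncurry_of_continuous_of_measurable (fun ω => (hd ω).continuous) hF
  exact h.comp (hW.prodMk measurable_id)

lemma convex_candidates {d : ℕ} (R : ℝ) (S : Finset (Fin d)) : Convex ℝ (candidates R S) := by
  rintro x ⟨hx, hx'⟩ y ⟨hy, hy'⟩ a b ha hb hab
  refine ⟨?_, fun i hi => by simp [hx' i hi, hy' i hi]⟩
  calc l1Norm (a • x + b • y) ≤ ∑ i, (a * |x i| + b * |y i|) := by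
        refine Finset.sum_le_sum fun i _ => ?_
        simp only [PiLp.add_apply, PiLp.smul_apply, smul_eq_mul]
        refine (abs_add_le _ _).trans ?_
        rw [abs_mul, abs_mul, abs_of_nonneg ha, abs_of_nonneg hb]
    _ = a * l1Norm x + b * l1Norm y := by
        rw [Finset.sum_add_distrib, ← Finset.mul_sum, ← Finset.mul_sum]
        rfl
    _ ≤ a * R + b * R := by gcongr
    _ = R := by rw [← add_mul, hab, one_mul]

lemma measurableSet_candidates {d : ℕ} (R : ℝ) (S : Finset (Fin d)) :
    MeasurableSet (candidates R S) := by
  have h : IsClosed (candidates R S) := by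
    have h1 : IsClosed {w : Vec d | l1Norm w ≤ R} := by
      refine isClosed_le ?_ continuous_const
      unfold l1Norm
      fun_prop
    have h2 : IsClosed (⋂ i, ⋂ (_ : i ∉ S), {w : Vec d | w i = 0}) :=
      isClosed_iInter fun i => isClosed_iInter fun _ => isClosed_eq (by fun_prop) continuous_const
    convert h1.inter h2 using 1
    ext w
    simp [candidates]
  exact h.measurableSet

lemma l1Norm_smul {d : ℕ} (a : ℝ) (w : Vec d) : l1Norm (a • w) = |a| * l1Norm w := by
  simp [l1Norm, abs_mul, Finset.mul_sum]

lemma l1Norm_sub_sq_le {d : ℕ} {R : ℝ} {S : Finset (Fin d)} {w u : Vec d}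
    (hw : w ∈ candidates R S) (hu : u ∈ candidates R S) :
    l1Norm (w - u) ^ 2 ≤ S.card * ∑ i ∈ S, (w i - u i) ^ 2 := by
  have h : l1Norm (w - u) = ∑ i ∈ S, |w i - u i| := by
    refine (Finset.sum_subset (Finset.subset_univ S) fun i _ hi => ?_).symm
    simp [hw.2 i hi, hu.2 i hi]
  rw [h]
  simpa using sq_sum_le_card_mul_sum_sq (s := S) (f := fun i => |w i - u i|)

lemma abs_sum_gradient_mul_le {d : ℕ} {F : Vec d → ℝ} {B : ℝ} {z : Vec d}
    (hB : ∀ i, |gradient F z i| ≤ B) (v : Vec d) :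
    |∑ i, gradient F z i * v i| ≤ B * l1Norm v := by
  rw [l1Norm, Finset.mul_sum]
  refine (Finset.abs_sum_le_sum_abs _ _).trans (Finset.sum_le_sum fun i _ => ?_)
  rw [abs_mul]
  exact mul_le_mul_of_nonneg_right (hB i) (abs_nonneg _)

lemma abs_sub_le_mul_l1Norm {d : ℕ} {F : Vec d → ℝ} (hF : Differentiable ℝ F) {B R : ℝ}
    {S : Finset (Fin d)} (hB : ∀ w ∈ candidates R S, ∀ i, |gradient F w i| ≤ B) {w u : Vec d}
    (hw : w ∈ candidates R S) (hu : u ∈ candidates R S) :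
    |F w - F u| ≤ B * l1Norm (w - u) := by
  obtain ⟨z, hz, h⟩ := domain_mvt (fun x _ => (hF x).hasFDerivAt.hasFDerivWithinAt)
    (convex_candidates R S) hu hw
  rw [h, fderiv_apply_eq_sum]
  exact abs_sum_gradient_mul_le (hB z ((convex_candidates R S).segment_subset hu hw hz)) _

/-! ### The excess of a loss over its linearization -/

/-- `F(w) - F(u) - ⟪∇F(w), w - u⟫`, which is at most zero for convex `F`. -/
noncomputable def linearizationExcess {d : ℕ} (F : Vec d → ℝ) (u w : Vec d) : ℝ :=
  F w - F u - ∑ i, gradient F w i * (w i - u i)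

lemma continuous_linearizationExcess {d : ℕ} {F : Vec d → ℝ} (hF : ContDiff ℝ 1 F) (u : Vec d) :
    Continuous (linearizationExcess F u) := by
  unfold linearizationExcess
  refine (hF.continuous.sub continuous_const).sub (continuous_finsetSum _ fun i _ => ?_)
  exact (continuous_gradient_apply hF i).mul (by fun_prop)

lemma measurable_linearizationExcess_comp {Ω : Type*} [MeasurableSpace Ω] {d : ℕ}
    {F : Ω → Vec d → ℝ} (hF : ∀ w, Measurable fun ω => F ω w) (hd : ∀ ω, ContDiff ℝ 1 (F ω))
    (u : Vec d) {W : Ω → Vec d} (hW : Measurable W) :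
    Measurable fun ω => linearizationExcess (F ω) u (W ω) := by
  unfold linearizationExcess
  refine ((measurable_eval_comp hF hd hW).sub (hF u)).sub (Finset.measurable_sum _ fun i _ => ?_)
  refine (measurable_gradient_comp_apply hF hd hW i).mul (Measurable.sub_const ?_ _)
  exact (EuclideanSpace.proj (𝕜 := ℝ) i).continuous.measurable.comp hW

lemma abs_linearizationExcess_le {d : ℕ} {F : Vec d → ℝ} (hF : Differentiable ℝ F) {B R : ℝ}
    {S : Finset (Fin d)} (hB : ∀ w ∈ candidates R S, ∀ i, |gradient F w i| ≤ B) {w u : Vec d}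
    (hw : w ∈ candidates R S) (hu : u ∈ candidates R S) :
    |linearizationExcess F u w| ≤ 2 * B * l1Norm (w - u) := by
  have h1 := abs_sub_le_mul_l1Norm hF hB hw hu
  have h2 := abs_sum_gradient_mul_le (hB w hw) (w - u)
  calc |linearizationExcess F u w| ≤ |F w - F u| + |∑ i, gradient F w i * (w - u) i| := abs_sub _ _
    _ ≤ 2 * B * l1Norm (w - u) := by linarith

lemma strongConvexity_segment {d : ℕ} {L : Vec d → ℝ} {S : Finset (Fin d)} {α : ℝ}
    (hL : StrongConvexityInExpectation L S α) (w u : Vec d) {h : ℝ} (h0 : 0 ≤ h) (h1 : h ≤ 1) :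
    L (w + h • (u - w)) ≤ L w + h * (L u - L w)
      - α / 2 * (h * (1 - h)) * ∑ i ∈ S, (w i - u i) ^ 2 := by
  have hc := hL.2.2 (Set.mem_univ w) (Set.mem_univ u) (sub_nonneg.2 h1) h0 (by ring)
  have hp : (1 - h) • w + h • u = w + h • (u - w) := by module
  rw [hp] at hc
  simp only [smul_eq_mul] at hc
  have hs : ∑ i ∈ S, ((w + h • (u - w)) i) ^ 2 = (1 - h) * ∑ i ∈ S, w i ^ 2 + h * ∑ i ∈ S, u i ^ 2
      - h * (1 - h) * ∑ i ∈ S, (w i - u i) ^ 2 := by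
    rw [Finset.mul_sum, Finset.mul_sum, Finset.mul_sum, ← Finset.sum_add_distrib,
      ← Finset.sum_sub_distrib]
    refine Finset.sum_congr rfl fun i _ => ?_
    simp only [PiLp.add_apply, PiLp.smul_apply, PiLp.sub_apply, smul_eq_mul]
    ring
  rw [hs] at hc
  linarith

/-- Strong convexity of the expected loss makes the conditional mean of the excess of `F` at most
`-α / 2` times the squared distance. The expected gradient is controlled through difference
quotients, so that no differentiability of `L` is needed. -/
lemma setIntegral_linearizationExcess_le {Ω : Type*} {m : MeasurableSpace Ω}
    [mΩ : MeasurableSpace Ω] {μ : Measure Ω} [IsProbabilityMeasure μ] (hm : m ≤ mΩ) {d : ℕ}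
    {F : Ω → Vec d → ℝ} (hF : ∀ w, Measurable fun ω => F ω w) (hd : ∀ ω, ContDiff ℝ 1 (F ω))
    (hint : ∀ w, Integrable (fun ω => F ω w) μ) {L : Vec d → ℝ}
    (hcond : ∀ w, μ[fun ω => F ω w | m] =ᵐ[μ] fun _ => L w) {S : Finset (Fin d)} {α B R : ℝ}
    (hL : StrongConvexityInExpectation L S α)
    (hB : ∀ᵐ ω ∂μ, ∀ w ∈ candidates R S, ∀ i, |gradient (F ω) w i| ≤ B) {w u : Vec d}
    (hw : w ∈ candidates R S) (hu : u ∈ candidates R S) {A : Set Ω} (hA : MeasurableSet[m] A) :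
    ∫ ω in A, linearizationExcess (F ω) u w ∂μ ≤
      -(α / 2 * ∑ i ∈ S, (w i - u i) ^ 2) * μ.real A := by
  have hmean : ∀ v, ∫ ω in A, F ω v ∂μ = L v * μ.real A := by
    intro v
    rw [← setIntegral_condExp hm (hint v) hA,
      setIntegral_congr_ae (hm _ hA) ((hcond v).mono fun ω h _ => h)]
    simp [mul_comm]
  have hdiff : ∀ ω, Differentiable ℝ (F ω) := fun ω => (hd ω).differentiable one_ne_zero
  let c : ℕ → ℝ := fun n => (n : ℝ) + 1
  have hc : ∀ n, 0 < c n := fun n => by positivity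
  have hc1 : ∀ n, (c n)⁻¹ ≤ 1 := fun n => inv_le_one_of_one_le₀ (by simp [c])
  have hctop : Tendsto c atTop atTop :=
    tendsto_atTop_add_const_right _ _ tendsto_natCast_atTop_atTop
  have hmem : ∀ n, w + (c n)⁻¹ • (u - w) ∈ candidates R S := fun n =>
    (convex_candidates R S).add_smul_sub_mem hw hu ⟨(inv_pos.2 (hc n)).le, hc1 n⟩
  have hlim : Tendsto
      (fun n => ∫ ω in A, c n • (F ω (w + (c n)⁻¹ • (u - w)) - F ω w) ∂μ) atTop
      (𝓝 (∫ ω in A, fderiv ℝ (F ω) w (u - w) ∂μ)) := by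
    refine tendsto_integral_of_dominated_convergence (fun _ => B * l1Norm (u - w)) ?_
      (integrable_const _) ?_ ?_
    · exact fun n => (((hF _).fun_sub (hF w)).fun_const_smul _).aestronglyMeasurable
    · intro n
      refine ae_restrict_of_ae (hB.mono fun ω hω => ?_)
      have h := abs_sub_le_mul_l1Norm (hdiff ω) hω (hmem n) hw
      rw [add_sub_cancel_left, l1Norm_smul, abs_of_pos (inv_pos.2 (hc n))] at h
      rw [Real.norm_eq_abs, smul_eq_mul, abs_mul, abs_of_pos (hc n)]
      calc _ ≤ c n * (B * ((c n)⁻¹ * l1Norm (u - w))) := by gcongr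
        _ = _ := by have := (hc n).ne'; field_simp
    · refine Eventually.of_forall fun ω => ?_
      exact (hdiff ω w).hasFDerivAt.lim _ (tendsto_norm_atTop_atTop.comp hctop)
  have hquot : ∀ n, ∫ ω in A, c n • (F ω (w + (c n)⁻¹ • (u - w)) - F ω w) ∂μ ≤
      (L u - L w - α / 2 * (1 - (c n)⁻¹) * ∑ i ∈ S, (w i - u i) ^ 2) * μ.real A := by
    intro n
    rw [integral_smul, integral_sub (hint _).integrableOn (hint _).integrableOn, hmean, hmean,
      smul_eq_mul, ← sub_mul, ← mul_assoc]
    refine mul_le_mul_of_nonneg_right ?_ measureReal_nonneg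
    have h := strongConvexity_segment hL w u (inv_pos.2 (hc n)).le (hc1 n)
    calc c n * (L (w + (c n)⁻¹ • (u - w)) - L w)
        ≤ c n * ((c n)⁻¹ * (L u - L w) - α / 2 * ((c n)⁻¹ * (1 - (c n)⁻¹)) *
            ∑ i ∈ S, (w i - u i) ^ 2) :=
          mul_le_mul_of_nonneg_left (by linarith) (hc n).le
      _ = c n * (c n)⁻¹ * (L u - L w - α / 2 * (1 - (c n)⁻¹) * ∑ i ∈ S, (w i - u i) ^ 2) := by ring
      _ = _ := by rw [mul_inv_cancel₀ (hc n).ne', one_mul]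
  have hquotlim : Tendsto
      (fun n => (L u - L w - α / 2 * (1 - (c n)⁻¹) * ∑ i ∈ S, (w i - u i) ^ 2) * μ.real A) atTop
      (𝓝 ((L u - L w - α / 2 * (1 - 0) * ∑ i ∈ S, (w i - u i) ^ 2) * μ.real A)) :=
    ((tendsto_const_nhds.sub (((tendsto_const_nhds.sub
      (tendsto_inv_atTop_zero.comp hctop)).const_mul _).mul_const _)).mul_const _)
  have hle := le_of_tendsto_of_tendsto' hlim hquotlim hquot
  have hgrad : Integrable (fun ω => fderiv ℝ (F ω) w (u - w)) (μ.restrict A) := by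
    refine Integrable.of_bound (C := B * l1Norm (u - w)) ?_ ?_
    · simp only [fderiv_apply_eq_sum]
      exact (Finset.measurable_sum _ fun i _ =>
        (measurable_gradient_apply hF hdiff w i).mul_const _).aestronglyMeasurable
    · refine ae_restrict_of_ae (hB.mono fun ω hω => ?_)
      rw [fderiv_apply_eq_sum]
      exact abs_sum_gradient_mul_le (hω w hw) _
  have hexc : ∀ ω, linearizationExcess (F ω) u w =
      F ω w - F ω u + fderiv ℝ (F ω) w (u - w) := by
    intro ω
    rw [linearizationExcess, fderiv_apply_eq_sum, sub_eq_add_neg (F ω w - F ω u),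
      ← Finset.sum_neg_distrib]
    congr 1
    refine Finset.sum_congr rfl fun i _ => ?_
    simp only [PiLp.sub_apply]
    ring
  simp only [hexc]
  rw [integral_add ((hint w).integrableOn.fun_sub (hint u).integrableOn) hgrad,
    integral_sub (hint w).integrableOn (hint u).integrableOn, hmean, hmean]
  linarith

/-! ### A maximal inequality with square-root boundary -/

/-- On the epoch `4 ^ j ≤ n ≤ 4 ^ (j + 1)` the chord of the square root lies below it. -/
lemma chord_le_sqrt {j n : ℕ} (h₁ : 4 ^ j ≤ n) (h₂ : n ≤ 4 ^ (j + 1)) :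
    2 / 3 * (2 : ℝ) ^ j + n * (1 / (3 * 2 ^ j)) ≤ √(n : ℝ) := by
  have hq : (0 : ℝ) < 2 ^ j := by positivity
  have hsq : ((2 : ℝ) ^ j) ^ 2 = 4 ^ j := by
    rw [← pow_mul, mul_comm, pow_mul]
    norm_num
  have h1 : (2 : ℝ) ^ j ≤ √(n : ℝ) := by
    apply Real.le_sqrt_of_sq_le
    rw [hsq]
    exact_mod_cast h₁
  have h2 : √(n : ℝ) ≤ 2 * 2 ^ j := by
    apply Real.sqrt_le_iff.2 ⟨by positivity, ?_⟩
    rw [mul_pow, hsq]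
    have : (n : ℝ) ≤ 4 ^ (j + 1) := by exact_mod_cast h₂
    rw [pow_succ] at this
    linarith
  have h3 : (n : ℝ) = √(n : ℝ) ^ 2 := (Real.sq_sqrt (by positivity)).symm
  have h4 : 2 / 3 * (2 : ℝ) ^ j + n * (1 / (3 * 2 ^ j)) =
      (2 * (2 ^ j) ^ 2 + n) / (3 * 2 ^ j) := by
    field_simp
  rw [h4, div_le_iff₀ (by positivity)]
  nlinarith [mul_nonneg (sub_nonneg.2 h1) (sub_nonneg.2 h2)]

section Peeling

variable {Ω : Type*} [mΩ : MeasurableSpace Ω] {μ : Measure Ω} [IsProbabilityMeasure μ]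

/-- Crossing a line: a process with conditionally sub-Gaussian increments exceeds the level
`a + b n` at some time with probability at most `exp (-2 a b / B ^ 2)`. -/
lemma measure_exists_line_le {T : ℕ} {m : ℕ → MeasurableSpace Ω} (hmono : Monotone m)
    (hm : ∀ n ≤ T, m n ≤ mΩ) {G : ℕ → Ω → ℝ} (hG : ∀ n < T, Measurable[m (n + 1)] (G n)) {B : ℝ}
    (hB : 0 < B)
    (hle : ∀ s : ℝ, 0 ≤ s → ∀ n < T, ∀ A, MeasurableSet[m n] A →
      ∫⁻ ω in A, ENNReal.ofReal (Real.exp (s * G n ω - s ^ 2 * B ^ 2 / 2)) ∂μ ≤ μ A)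
    (a : ℝ) {b : ℝ} (hb : 0 ≤ b) :
    μ {ω | ∃ n ≤ T, a + b * n ≤ ∑ j ∈ Finset.range n, G j ω} ≤
      ENNReal.ofReal (Real.exp (-(2 * a * b / B ^ 2))) := by
  have hs : 0 ≤ 2 * b / B ^ 2 := by positivity
  have hville := measure_exists_le_prod_le (μ := μ) hmono hm
    (h := fun n ω => ENNReal.ofReal (Real.exp (2 * b / B ^ 2 * G n ω -
      (2 * b / B ^ 2) ^ 2 * B ^ 2 / 2)))
    (fun n hn => (Real.measurable_exp.comp
      (((hG n hn).const_mul _).sub_const _)).ennreal_ofReal)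
    (fun n hn A hA => hle _ hs n hn A hA) (c := ENNReal.ofReal (Real.exp (2 * a * b / B ^ 2)))
    (by simp [Real.exp_pos]) ENNReal.ofReal_ne_top
  rw [← ENNReal.ofReal_inv_of_pos (Real.exp_pos _), ← Real.exp_neg] at hville
  refine (measure_mono ?_).trans hville
  rintro ω ⟨n, hn, h⟩
  refine ⟨n, hn, ?_⟩
  rw [← ENNReal.ofReal_prod_of_nonneg fun _ _ => (Real.exp_pos _).le, ← Real.exp_sum]
  refine ENNReal.ofReal_le_ofReal (Real.exp_le_exp.2 ?_)
  rw [Finset.sum_sub_distrib, ← Finset.mul_sum, Finset.sum_const, Finset.card_range, nsmul_eq_mul]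
  have h1 := mul_le_mul_of_nonneg_left h hs
  have h2 : 2 * b / B ^ 2 * (a + b * n) =
      2 * a * b / B ^ 2 + n * ((2 * b / B ^ 2) ^ 2 * B ^ 2 / 2) := by
    field_simp
  linarith

/-- A process with conditionally sub-Gaussian increments exceeds `lam * √n` only with small
probability, uniformly in `n ≤ T`. On each epoch `[4 ^ j, 4 ^ (j + 1)]` the boundary is replaced by
its chord `a + b n`, for which `2 a b = 4 lam ^ 2 / 9` whatever the epoch. -/
lemma measure_exists_sqrt_lt_le {T : ℕ} {m : ℕ → MeasurableSpace Ω} (hmono : Monotone m)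
    (hm : ∀ n ≤ T, m n ≤ mΩ) {G : ℕ → Ω → ℝ} (hG : ∀ n < T, Measurable[m (n + 1)] (G n)) {B : ℝ}
    (hB : 0 < B)
    (hle : ∀ s : ℝ, 0 ≤ s → ∀ n < T, ∀ A, MeasurableSet[m n] A →
      ∫⁻ ω in A, ENNReal.ofReal (Real.exp (s * G n ω - s ^ 2 * B ^ 2 / 2)) ∂μ ≤ μ A)
    {lam : ℝ} (hlam : 0 ≤ lam) :
    μ {ω | ∃ n ≤ T, lam * √(n : ℝ) < ∑ j ∈ Finset.range n, G j ω} ≤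
      ENNReal.ofReal ((Nat.log 4 T + 1) * Real.exp (-(4 / 9 * lam ^ 2 / B ^ 2))) := by
  have hsub : {ω | ∃ n ≤ T, lam * √(n : ℝ) < ∑ j ∈ Finset.range n, G j ω} ⊆
      ⋃ j ∈ Finset.range (Nat.log 4 T + 1), {ω | ∃ n ≤ T,
        lam * (2 / 3 * 2 ^ j) + lam * (1 / (3 * 2 ^ j)) * n ≤ ∑ j ∈ Finset.range n, G j ω} := by
    rintro ω ⟨n, hn, h⟩
    rcases Nat.eq_zero_or_pos n with rfl | hpos
    · simp at h
    · simp only [Set.mem_iUnion]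
      refine ⟨Nat.log 4 n,
        Finset.mem_range.2 (Nat.lt_succ_of_le (Nat.log_mono_right hn)), n, hn, ?_⟩
      have hc := chord_le_sqrt (Nat.pow_log_le_self 4 hpos.ne')
        (Nat.lt_pow_succ_log_self (by norm_num) n).le
      have := mul_le_mul_of_nonneg_left hc hlam
      linarith
  have hline : ∀ j : ℕ, μ {ω | ∃ n ≤ T,
        lam * (2 / 3 * 2 ^ j) + lam * (1 / (3 * 2 ^ j)) * n ≤ ∑ j ∈ Finset.range n, G j ω} ≤
      ENNReal.ofReal (Real.exp (-(4 / 9 * lam ^ 2 / B ^ 2))) := by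
    intro j
    refine (measure_exists_line_le hmono hm hG hB hle (lam * (2 / 3 * 2 ^ j))
      (b := lam * (1 / (3 * 2 ^ j))) (by positivity)).trans (le_of_eq ?_)
    congr 4
    field_simp
    ring
  calc _ ≤ _ := measure_mono hsub
    _ ≤ ∑ j ∈ Finset.range (Nat.log 4 T + 1), μ {ω | ∃ n ≤ T,
        lam * (2 / 3 * 2 ^ j) + lam * (1 / (3 * 2 ^ j)) * n ≤ ∑ j ∈ Finset.range n, G j ω} :=
        measure_biUnion_finset_le _ _
    _ ≤ ∑ j ∈ Finset.range (Nat.log 4 T + 1),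
        ENNReal.ofReal (Real.exp (-(4 / 9 * lam ^ 2 / B ^ 2))) :=
        Finset.sum_le_sum fun j _ => hline j
    _ = _ := by
        rw [Finset.sum_const, Finset.card_range, nsmul_eq_mul, ENNReal.ofReal_mul (by positivity)]
        congr 1
        rw [← Nat.cast_succ, ENNReal.ofReal_natCast]

end Peeling

/-! ### The filtration of past losses -/

section Filtration

variable {Ω : Type*} {d : ℕ} {f : ℕ → Ω → Vec d → ℝ}

lemma past_mono (f : ℕ → Ω → Vec d → ℝ) : Monotone (past f) := fun _ _ hst =>
  biSup_mono fun _ hr => ⟨hr.1, hr.2.trans_le hst⟩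

lemma measurable_past {s t : ℕ} (hs : 1 ≤ s) (hst : s < t) (w : Vec d) :
    Measurable[past f t] fun ω => f s ω w := by
  have h : Measurable[past f t] (f s) := by
    rw [measurable_iff_comap_le]
    exact le_iSup₂ (f := fun s (_ : s ∈ Set.Ico 1 t) =>
      MeasurableSpace.comap (f s) MeasurableSpace.pi) s ⟨hs, hst⟩
  exact (measurable_pi_apply w).comp h

lemma past_le [mΩ : MeasurableSpace Ω] {T t : ℕ} (hf : IsLossSequence T f) (ht : t ≤ T + 1) :
    past f t ≤ mΩ := by
  refine iSup₂_le fun s hs => ?_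
  rw [← measurable_iff_comap_le]
  exact measurable_pi_iff.2 (hf.measurable s (Finset.mem_Icc.2 ⟨hs.1, by have := hs.2; omega⟩))

lemma theta_succ_succ (η lam ε : ℝ) (g : ℕ → Vec d → ℝ) (n : ℕ) :
    theta η lam ε g (n + 2) = theta η lam ε g (n + 1) -
      (gradient (g (n + 1)) (weight η lam ε g (n + 1)) - η • weight η lam ε g (n + 1)) := rfl

lemma measurable_sparsify (η lam ε : ℝ) (t : ℕ) :
    Measurable (sparsify (d := d) η lam ε t) := by
  have hsoft : ∀ c, Measurable (softThreshold c) := by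
    intro c
    unfold softThreshold
    refine Measurable.ite (measurableSet_lt (by fun_prop) measurable_const) measurable_const ?_
    have hsign : Measurable Real.sign := by
      unfold Real.sign
      exact Measurable.ite measurableSet_Iio measurable_const
        (Measurable.ite measurableSet_Ioi measurable_const measurable_const)
    fun_prop
  have h : Measurable fun θ : Vec d => WithLp.toLp 2
      fun i => softThreshold (lam * √((t : ℝ) + 1)) (θ i) :=
    (WithLp.measurable_toLp 2 (Fin d → ℝ)).comp (measurable_pi_iff.2 fun i =>
      (hsoft _).comp (EuclideanSpace.proj (𝕜 := ℝ) i).continuous.measurable)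
  exact h.const_smul (1 / (ε + η * ((t : ℝ) - 1)))

/-- The iterates are predictable: `θ_t` depends on `f_1, …, f_{t-1}` only. -/
lemma measurable_theta [MeasurableSpace Ω] {T : ℕ} (hf : IsLossSequence T f) (η lam ε : ℝ) {n : ℕ}
    (hn : n ≤ T) :
    Measurable[past f (n + 1)] fun ω => theta η lam ε (fun s => f s ω) (n + 1) := by
  induction n with
  | zero => exact measurable_const
  | succ n ih =>
    have ih' := (ih (by omega)).mono (past_mono f (Nat.le_succ _)) le_rfl
    have hw : Measurable[past f (n + 1 + 1)] fun ω => weight η lam ε (fun s => f s ω) (n + 1) :=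
      (measurable_sparsify η lam ε (n + 1)).comp ih'
    have hgrad : Measurable[past f (n + 1 + 1)] fun ω =>
        gradient (f (n + 1) ω) (weight η lam ε (fun s => f s ω) (n + 1)) :=
      @measurable_gradient_comp Ω (past f (n + 1 + 1)) d
        (f (n + 1)) (measurable_past (by omega) (by omega))
        (hf.contDiff (n + 1) (Finset.mem_Icc.2 ⟨by omega, hn⟩)) _ hw
    simp only [theta_succ_succ]
    exact ih'.sub (hgrad.sub (hw.const_smul η))

lemma measurable_weight [MeasurableSpace Ω] {T : ℕ} (hf : IsLossSequence T f) (η lam ε : ℝ) {n : ℕ}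
    (hn : n ≤ T) :
    Measurable[past f (n + 1)] fun ω => weight η lam ε (fun s => f s ω) (n + 1) :=
  (measurable_sparsify η lam ε (n + 1)).comp (measurable_theta hf η lam ε hn)

end Filtration

/-! ### Tail bounds along predictable candidate vectors -/

section Tails

variable {Ω : Type*} [mΩ : MeasurableSpace Ω] {μ : Measure Ω} [IsProbabilityMeasure μ] {d T k : ℕ}
  {f : ℕ → Ω → Vec d → ℝ} {S : Finset (Fin d)} {R B : ℝ}

/-- Given the past, a signed noise gradient at a predictable candidate is sub-Gaussian with variance
proxy `B ^ 2`. -/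
lemma setLIntegral_exp_noise_le (hf : IsLossSequence T f) (hB : BoundedGradients μ T f S R B)
    (hnoise : OrthogonalNoise μ T f S R) {W : ℕ → Ω → Vec d}
    (hW : ∀ n < T, Measurable[past f (n + 1)] (W n)) (hWH : ∀ n ω, W n ω ∈ candidates R S)
    {i : Fin d} (hi : i ∉ S) {σ : ℝ} (hσ : |σ| = 1) {s : ℝ} (hs : 0 ≤ s) {n : ℕ} (hn : n < T)
    {A : Set Ω} (hA : MeasurableSet[past f (n + 1)] A) :
    ∫⁻ ω in A, ENNReal.ofReal (Real.exp (s * (σ * gradient (f (n + 1) ω) (W n ω) i)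
      - s ^ 2 * B ^ 2 / 2)) ∂μ ≤ μ A := by
  have hn' : n + 1 ∈ Finset.Icc 1 T := Finset.mem_Icc.2 ⟨by omega, hn⟩
  have hm : past f (n + 1) ≤ mΩ := past_le hf (by omega)
  have hcd := hf.contDiff (n + 1) hn'
  have hmeas := fun w => measurable_gradient_apply (hf.measurable (n + 1) hn')
    (fun ω => (hcd ω).differentiable one_ne_zero) w i
  refine setLIntegral_comp_le hm (h := fun ω w => ENNReal.ofReal (Real.exp
    (s * (σ * gradient (f (n + 1) ω) w i) - s ^ 2 * B ^ 2 / 2))) ?_ ?_ ?_ (hW n hn) (hWH n) hA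
  · intro ω
    exact ENNReal.continuous_ofReal.comp (Real.continuous_exp.comp ((continuous_const.mul
      (continuous_const.mul (continuous_gradient_apply (hcd ω) i))).sub continuous_const))
  · intro w
    have hexp : ∀ {X : Ω → ℝ}, Measurable X → Measurable fun ω =>
        ENNReal.ofReal (Real.exp (s * (σ * X ω) - s ^ 2 * B ^ 2 / 2)) := by
      intro X hX
      fun_prop
    exact hexp (hmeas w)
  · intro w hw A hA
    have hbound : ∀ᵐ ω ∂μ, |σ * gradient (f (n + 1) ω) w i| ≤ B := by
      filter_upwards [hB] with ω hω
      rw [abs_mul, hσ, one_mul]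
      exact hω (n + 1) hn' w hw i
    have hint : Integrable (fun ω => gradient (f (n + 1) ω) w i) μ := by
      refine Integrable.of_bound (C := B) (hmeas w).aestronglyMeasurable ?_
      filter_upwards [hB] with ω hω using hω (n + 1) hn' w hw i
    have hmean : ∫ ω in A, σ * gradient (f (n + 1) ω) w i ∂μ ≤ 0 * μ.real A := by
      rw [integral_const_mul, ← setIntegral_condExp hm hint hA,
        setIntegral_congr_ae (hm _ hA) ((hnoise (n + 1) hn' w hw i hi).mono fun ω h _ => h)]
      simp
    simpa using setLIntegral_exp_le ((hmeas w).const_mul σ) hbound hs hmean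

/-- Given the past, the excess at a predictable candidate is sub-Gaussian around the mean allowed by
strong convexity, with a variance proxy that shrinks with the distance to `u`. -/
lemma setLIntegral_exp_excess_le (hf : IsLossSequence T f) {L : Vec d → ℝ} {u : Vec d}
    (hL : StatisticalSparsity μ T k f L u S R) {α : ℝ}
    (hconv : StrongConvexityInExpectation L S α) (hB : BoundedGradients μ T f S R B)
    {W : ℕ → Ω → Vec d} (hW : ∀ n < T, Measurable[past f (n + 1)] (W n))
    (hWH : ∀ n ω, W n ω ∈ candidates R S) (hu : u ∈ candidates R S) {s : ℝ} (hs : 0 ≤ s) {n : ℕ}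
    (hn : n < T) {A : Set Ω} (hA : MeasurableSet[past f (n + 1)] A) :
    ∫⁻ ω in A, ENNReal.ofReal (Real.exp (s * linearizationExcess (f (n + 1) ω) u (W n ω)
      - s * -(α / 2 * ∑ i ∈ S, (W n ω i - u i) ^ 2)
      - s ^ 2 * (2 * B * l1Norm (W n ω - u)) ^ 2 / 2)) ∂μ ≤ μ A := by
  have hn' : n + 1 ∈ Finset.Icc 1 T := Finset.mem_Icc.2 ⟨by omega, hn⟩
  have hm : past f (n + 1) ≤ mΩ := past_le hf (by omega)
  have hcd := hf.contDiff (n + 1) hn'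
  have hmeas := fun w => measurable_linearizationExcess_comp (hf.measurable (n + 1) hn') hcd u
    (measurable_const (a := w))
  have hBn : ∀ᵐ ω ∂μ, ∀ w ∈ candidates R S, ∀ i, |gradient (f (n + 1) ω) w i| ≤ B :=
    hB.mono fun ω hω => hω (n + 1) hn'
  refine setLIntegral_comp_le hm (h := fun ω w => ENNReal.ofReal (Real.exp
    (s * linearizationExcess (f (n + 1) ω) u w - s * -(α / 2 * ∑ i ∈ S, (w i - u i) ^ 2)
      - s ^ 2 * (2 * B * l1Norm (w - u)) ^ 2 / 2))) ?_ ?_ ?_ (hW n hn) (hWH n) hA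
  · intro ω
    have := continuous_linearizationExcess (hcd ω) u
    refine ENNReal.continuous_ofReal.comp ?_
    unfold l1Norm
    fun_prop
  · intro w
    have := hmeas w
    fun_prop
  · intro w hw A hA
    refine setLIntegral_exp_le (hmeas w) ?_ hs ?_
    · filter_upwards [hBn] with ω hω
      exact abs_linearizationExcess_le ((hcd ω).differentiable one_ne_zero) hω hw hu
    · exact setIntegral_linearizationExcess_le hm (hf.measurable (n + 1) hn') hcd
        (hL.integrable (n + 1) hn') (hL.condExp_eq (n + 1) hn') hconv hBn hw hu hA

/-- With high probability the summed noise gradients stay below the soft-threshold level, for all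
coordinates and times at once. -/
lemma measure_exists_noise_gt_le (hf : IsLossSequence T f) (hB : BoundedGradients μ T f S R B)
    (hnoise : OrthogonalNoise μ T f S R) {W : ℕ → Ω → Vec d}
    (hW : ∀ n < T, Measurable[past f (n + 1)] (W n)) (hWH : ∀ n ω, W n ω ∈ candidates R S)
    (hB0 : 0 < B) {lam : ℝ} (hlam : 0 ≤ lam) :
    μ {ω | ∃ n ≤ T, ∃ i ∉ S, lam * √((n : ℝ) + 2) <
        |∑ j ∈ Finset.range n, gradient (f (j + 1) ω) (W j ω) i|} ≤
      ENNReal.ofReal (2 * d * (Nat.log 4 T + 1) * Real.exp (-(4 / 9 * lam ^ 2 / B ^ 2))) := by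
  let E : Fin d → ℝ → Set Ω := fun i σ => {ω | ∃ n ≤ T,
    lam * √(n : ℝ) < ∑ j ∈ Finset.range n, σ * gradient (f (j + 1) ω) (W j ω) i}
  set p := ENNReal.ofReal ((Nat.log 4 T + 1) * Real.exp (-(4 / 9 * lam ^ 2 / B ^ 2))) with hp
  have hE : ∀ i ∉ S, ∀ σ : ℝ, |σ| = 1 → μ (E i σ) ≤ p := by
    intro i hi σ hσ
    refine measure_exists_sqrt_lt_le (m := fun n => past f (n + 1))
      (G := fun n ω => σ * gradient (f (n + 1) ω) (W n ω) i)
      (fun a b hab => past_mono f (by omega)) (fun n hn => past_le hf (by omega)) ?_ hB0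
      (fun s hs n hn A hA => setLIntegral_exp_noise_le hf hB hnoise hW hWH hi hσ hs hn hA) hlam
    intro n hn
    refine Measurable.const_mul ?_ σ
    exact @measurable_gradient_comp_apply Ω (past f (n + 1 + 1)) d (f (n + 1))
      (measurable_past (by omega) (by omega))
      (hf.contDiff (n + 1) (Finset.mem_Icc.2 ⟨by omega, hn⟩)) _
      ((hW n hn).mono (past_mono f (Nat.le_succ _)) le_rfl) i
  have hsub : {ω | ∃ n ≤ T, ∃ i ∉ S, lam * √((n : ℝ) + 2) <
        |∑ j ∈ Finset.range n, gradient (f (j + 1) ω) (W j ω) i|} ⊆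
      ⋃ i ∈ Finset.univ.filter (· ∉ S), (E i 1 ∪ E i (-1)) := by
    rintro ω ⟨n, hn, i, hi, h⟩
    have hle : lam * √(n : ℝ) ≤ lam * √((n : ℝ) + 2) := by gcongr; linarith
    simp only [Set.mem_iUnion, Finset.mem_filter, Finset.mem_univ, true_and]
    refine ⟨i, hi, ?_⟩
    rcases lt_abs.1 (hle.trans_lt h) with h | h
    · exact Or.inl ⟨n, hn, by simpa using h⟩
    · exact Or.inr ⟨n, hn, by simpa using h⟩
  calc _ ≤ _ := measure_mono hsub
    _ ≤ ∑ i ∈ Finset.univ.filter (· ∉ S), μ (E i 1 ∪ E i (-1)) := measure_biUnion_finset_le _ _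
    _ ≤ ∑ i ∈ Finset.univ.filter (· ∉ S), 2 * p := by
        refine Finset.sum_le_sum fun i hi => (measure_union_le _ _).trans ?_
        rw [two_mul]
        exact add_le_add (hE i (Finset.mem_filter.1 hi).2 1 (by simp))
          (hE i (Finset.mem_filter.1 hi).2 (-1) (by simp))
    _ ≤ ∑ i : Fin d, 2 * p := Finset.sum_le_sum_of_subset (Finset.filter_subset _ _)
    _ = _ := by
        rw [Finset.sum_const, Finset.card_univ, Fintype.card_fin, nsmul_eq_mul, hp,
          mul_assoc (2 * (d : ℝ)), ENNReal.ofReal_mul (by positivity : 0 ≤ 2 * (d : ℝ)),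
          ENNReal.ofReal_mul (by positivity : (0 : ℝ) ≤ 2), ENNReal.ofReal_natCast,
          ENNReal.ofReal_ofNat]
        ring

/-- With high probability the total excess of the losses over their linearizations is at most
`-3 α / 8` times the total squared distance, up to a constant. The rate `s = α / (16 k B ^ 2)`
makes the variance term a quarter of the drift. -/
lemma measure_excess_gt_le (hf : IsLossSequence T f) {L : Vec d → ℝ} {u : Vec d}
    (hL : StatisticalSparsity μ T k f L u S R) {α : ℝ}
    (hconv : StrongConvexityInExpectation L S α) (hB : BoundedGradients μ T f S R B)
    {W : ℕ → Ω → Vec d} (hW : ∀ n < T, Measurable[past f (n + 1)] (W n))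
    (hWH : ∀ n ω, W n ω ∈ candidates R S) (hB0 : 0 < B) (hk : 0 < k) (c : ℝ) :
    μ {ω | 16 * k * B ^ 2 / α * c < ∑ n ∈ Finset.range T,
        (linearizationExcess (f (n + 1) ω) u (W n ω) +
          3 * α / 8 * ∑ i ∈ S, (W n ω i - u i) ^ 2)} ≤ ENNReal.ofReal (Real.exp (-c)) := by
  have hα : 0 < α := hconv.1
  have hk' : (0 : ℝ) < k := by exact_mod_cast hk
  have hu : u ∈ candidates R S :=
    ⟨hL.l1Norm_le, fun i hi => by_contra fun h => hi ((hL.support_eq i).1 h)⟩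
  set s : ℝ := α / (16 * k * B ^ 2) with hs
  have hs0 : 0 < s := by positivity
  let V : ℕ → Ω → ℝ := fun n ω => s * linearizationExcess (f (n + 1) ω) u (W n ω)
      - s * -(α / 2 * ∑ i ∈ S, (W n ω i - u i) ^ 2)
      - s ^ 2 * (2 * B * l1Norm (W n ω - u)) ^ 2 / 2
  have hVm : ∀ n < T, Measurable[past f (n + 1 + 1)] (V n) := by
    intro n hn
    have hWn := (hW n hn).mono (past_mono f (Nat.le_succ _)) le_rfl
    have h1 := @measurable_linearizationExcess_comp Ω (past f (n + 1 + 1)) d (f (n + 1))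
      (measurable_past (by omega) (by omega))
      (hf.contDiff (n + 1) (Finset.mem_Icc.2 ⟨by omega, hn⟩)) u _ hWn
    have h2 : Measurable fun w : Vec d => s * -(α / 2 * ∑ i ∈ S, (w i - u i) ^ 2) :=
      Continuous.measurable (by fun_prop)
    have h3 : Measurable fun w : Vec d => s ^ 2 * (2 * B * l1Norm (w - u)) ^ 2 / 2 :=
      Continuous.measurable (by unfold l1Norm; fun_prop)
    exact ((h1.const_mul s).sub (h2.comp hWn)).sub (h3.comp hWn)
  have hV : ∀ n ω, s * (linearizationExcess (f (n + 1) ω) u (W n ω) +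
      3 * α / 8 * ∑ i ∈ S, (W n ω i - u i) ^ 2) ≤ V n ω := by
    intro n ω
    have h1 := l1Norm_sub_sq_le (hWH n ω) hu
    have h2 : l1Norm (W n ω - u) ^ 2 ≤ k * ∑ i ∈ S, (W n ω i - u i) ^ 2 := by
      refine h1.trans ?_
      gcongr
      exact hL.card_le
    have h3 := mul_le_mul_of_nonneg_left h2 (by positivity : 0 ≤ 2 * s ^ 2 * B ^ 2)
    have h4 : 2 * s ^ 2 * B ^ 2 * (k * ∑ i ∈ S, (W n ω i - u i) ^ 2) =
        s * (α / 8) * ∑ i ∈ S, (W n ω i - u i) ^ 2 := by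
      have : 2 * s * B ^ 2 * k = α / 8 := by
        rw [hs]
        field_simp
        norm_num
      rw [← this]
      ring
    simp only [V]
    linarith
  have hville := measure_exists_le_prod_le (μ := μ) (T := T) (m := fun n => past f (n + 1))
    (fun a b hab => past_mono f (by omega)) (fun n hn => past_le hf (by omega))
    (h := fun n ω => ENNReal.ofReal (Real.exp (V n ω)))
    (fun n hn => (Real.measurable_exp.comp (hVm n hn)).ennreal_ofReal)
    (fun n hn A hA => setLIntegral_exp_excess_le hf hL hconv hB hW hWH hu hs0.le hn hA)
    (c := ENNReal.ofReal (Real.exp c)) (by simp [Real.exp_pos]) ENNReal.ofReal_ne_top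
  rw [← ENNReal.ofReal_inv_of_pos (Real.exp_pos _), ← Real.exp_neg] at hville
  refine (measure_mono fun ω hω => ?_).trans hville
  refine ⟨T, le_rfl, ?_⟩
  rw [← ENNReal.ofReal_prod_of_nonneg fun _ _ => (Real.exp_pos _).le, ← Real.exp_sum]
  refine ENNReal.ofReal_le_ofReal (Real.exp_le_exp.2 ?_)
  refine le_trans ?_ (Finset.sum_le_sum fun n _ => hV n ω)
  rw [← Finset.mul_sum]
  have h1 := mul_le_mul_of_nonneg_left (le_of_lt hω) hs0.le
  have h2 : s * (16 * k * B ^ 2 / α * c) = c := by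
    rw [hs]
    field_simp
  rwa [h2] at h1

end Tails

/-! ### The iterates on a fixed sequence of losses -/

section Path

variable {d T : ℕ} {g : ℕ → Vec d → ℝ} {S : Finset (Fin d)} {η lam R B : ℝ}

lemma weight_succ_apply (η lam : ℝ) (g : ℕ → Vec d → ℝ) (n : ℕ) (i : Fin d) :
    weight η lam 0 g (n + 1) i =
      1 / (η * n) * softThreshold (lam * √((n : ℝ) + 2)) (theta η lam 0 g (n + 1) i) := by
  have h : ((n : ℝ) + 1 + 1) = n + 2 := by ring
  simp [weight, sparsify, h]

lemma softThreshold_eq_zero {c x : ℝ} (h : |x| ≤ c) : softThreshold c x = 0 := by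
  unfold softThreshold
  split_ifs with hlt
  · rfl
  · rw [← le_antisymm h (not_lt.1 hlt)]
    rcases lt_trichotomy x 0 with hx | rfl | hx
    · rw [Real.sign_of_neg hx, abs_of_neg hx]
      ring
    · simp
    · rw [Real.sign_of_pos hx, abs_of_pos hx]
      ring

/-- As long as the summed noise gradients stay below the threshold, no noise coordinate enters the
iterates: for `i ∉ S`, `θ i` is then minus the sum of the noise gradients. The gradients are taken
at vectors `W n` that agree with the iterates whenever these are candidates. -/
lemma weight_mem_candidates (hl1 : ∀ t ∈ Finset.Icc 1 T, l1Norm (weight η lam 0 g t) ≤ R)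
    {W : ℕ → Vec d}
    (hW : ∀ n, weight η lam 0 g (n + 1) ∈ candidates R S → W n = weight η lam 0 g (n + 1))
    (hnoise : ∀ n ≤ T, ∀ i ∉ S,
      |∑ j ∈ Finset.range n, gradient (g (j + 1)) (W j) i| ≤ lam * √((n : ℝ) + 2))
    {n : ℕ} (hn : n < T) : weight η lam 0 g (n + 1) ∈ candidates R S := by
  have hmem : ∀ n < T, (∀ i ∉ S, theta η lam 0 g (n + 1) i =
      -∑ j ∈ Finset.range n, gradient (g (j + 1)) (W j) i) →
      weight η lam 0 g (n + 1) ∈ candidates R S := by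
    intro n hn hθ
    refine ⟨hl1 _ (Finset.mem_Icc.2 ⟨by omega, hn⟩), fun i hi => ?_⟩
    rw [weight_succ_apply, softThreshold_eq_zero, mul_zero]
    rw [hθ i hi, abs_neg]
    exact hnoise n hn.le i hi
  refine hmem n hn ?_
  induction n with
  | zero => intro i _; simp [theta]
  | succ n ih =>
    intro i hi
    have hw := hmem n (by omega) (ih (by omega))
    rw [theta_succ_succ, PiLp.sub_apply, ih (by omega) i hi, PiLp.sub_apply, PiLp.smul_apply,
      hw.2 i hi, Finset.sum_range_succ, hW n hw, smul_zero]
    ring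

/-- The linear regret of the algorithm against a candidate, as long as the iterates are
candidates. -/
lemma linear_regret_le (hη : 0 < η) (hlam : 0 ≤ lam) (hT : 3 ≤ T)
    (hw : ∀ n < T, weight η lam 0 g (n + 1) ∈ candidates R S)
    (hB : ∀ t ∈ Finset.Icc 1 T, ∀ w ∈ candidates R S, ∀ i, |gradient (g t) w i| ≤ B)
    {u : Vec d} (hu : u ∈ candidates R S) :
    ∑ n ∈ Finset.range T, ∑ i, gradient (g (n + 1)) (weight η lam 0 g (n + 1)) i *
        (weight η lam 0 g (n + 1) i - u i) ≤
      3 / 4 * η * ∑ n ∈ Finset.range T, ∑ i ∈ S, (weight η lam 0 g (n + 1) i - u i) ^ 2 +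
        S.card * ((6 * lam ^ 2 + 2 * B ^ 2) / η * Real.log T) := by
  have hcoord : ∀ i ∈ S, ∑ n ∈ Finset.range T,
      gradient (g (n + 1)) (weight η lam 0 g (n + 1)) i * (weight η lam 0 g (n + 1) i - u i) ≤
      3 / 4 * η * ∑ n ∈ Finset.range T, (weight η lam 0 g (n + 1) i - u i) ^ 2 +
        (6 * lam ^ 2 + 2 * B ^ 2) / η * Real.log T := by
    intro i _
    have hc : ∀ n : ℕ, 0 ≤ lam * √((n : ℝ) + 2) := fun n => by positivity
    have hmul : ∀ n : ℕ, η * n * weight η lam 0 g (n + 1) i =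
        softThreshold (lam * √((n : ℝ) + 2)) (theta η lam 0 g (n + 1) i) := by
      intro n
      rw [weight_succ_apply]
      rcases Nat.eq_zero_or_pos n with rfl | hn
      · have : theta η lam 0 g (0 + 1) i = 0 := rfl
        rw [this, softThreshold_eq_zero (by simpa using hc 0)]
        simp
      · have : (0 : ℝ) < n := by exact_mod_cast hn
        field_simp
    refine coordinate_regret_le hη hlam (θ := fun n => theta η lam 0 g (n + 1) i)
      (w := fun n => weight η lam 0 g (n + 1) i)
      (g := fun n => gradient (g (n + 1)) (weight η lam 0 g (n + 1)) i)
      rfl ?_ ?_ ?_ ?_ hT ?_ (u i)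
    · simp [weight_succ_apply]
    · intro n
      simp only [theta_succ_succ, PiLp.sub_apply, PiLp.smul_apply, smul_eq_mul]
    · intro n
      simp only [hmul]
      exact (softThreshold_subgradient (hc n) _).1
    · intro n
      simp only [hmul]
      have h := (softThreshold_subgradient (hc n) (theta η lam 0 g (n + 1) i)).2
      rw [weight_succ_apply, abs_mul, abs_of_nonneg (by positivity : 0 ≤ 1 / (η * (n : ℝ))),
        mul_left_comm, h]
      ring
    · exact fun n hn => hB _ (Finset.mem_Icc.2 ⟨by omega, hn⟩) _ (hw n hn) i
  have hS : ∀ n ∈ Finset.range T, ∑ i, gradient (g (n + 1)) (weight η lam 0 g (n + 1)) i *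
        (weight η lam 0 g (n + 1) i - u i) =
      ∑ i ∈ S, gradient (g (n + 1)) (weight η lam 0 g (n + 1)) i *
        (weight η lam 0 g (n + 1) i - u i) := by
    intro n hn
    refine (Finset.sum_subset (Finset.subset_univ S) fun i _ hi => ?_).symm
    rw [(hw n (Finset.mem_range.1 hn)).2 i hi, hu.2 i hi, sub_zero, mul_zero]
  rw [Finset.sum_congr rfl hS, Finset.sum_comm]
  refine (Finset.sum_le_sum hcoord).trans (le_of_eq ?_)
  rw [Finset.sum_add_distrib, ← Finset.mul_sum, Finset.sum_comm, Finset.sum_const, nsmul_eq_mul]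

end Path

/-! ### Constants and the union bound -/

lemma regret_eq_sum_range {d : ℕ} (g : ℕ → Vec d → ℝ) (w : ℕ → Vec d) (T : ℕ) (u : Vec d) :
    regret g w T u = ∑ n ∈ Finset.range T, (g (n + 1) (w (n + 1)) - g (n + 1) u) := by
  unfold regret
  induction T with
  | zero => simp
  | succ T ih => rw [Finset.sum_Icc_succ_top (by omega), Finset.sum_range_succ, ih]

lemma one_le_logb_two_mul {T : ℕ} (hT : 3 ≤ T) : 1 ≤ Real.logb 2 (2 * T) := by
  rw [Real.le_logb_iff_rpow_le (by norm_num) (by positivity)]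
  have : (3 : ℝ) ≤ T := by exact_mod_cast hT
  rw [Real.rpow_one]
  linarith

lemma natLog_four_add_one_le {T : ℕ} (hT : 3 ≤ T) :
    (Nat.log 4 T : ℝ) + 1 ≤ Real.logb 2 (2 * T) := by
  have hT' : (0 : ℝ) < T := by positivity
  rw [Real.logb_mul (by norm_num) hT'.ne', Real.logb_self_eq_one (by norm_num), add_comm]
  have h1 : Nat.log 4 T ≤ Nat.log 2 T := Nat.log_anti_left (by norm_num) (by norm_num)
  have h2 : (Nat.log 4 T : ℝ) ≤ Nat.log 2 T := by exact_mod_cast h1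
  have h3 := Real.natLog_le_logb T 2
  push_cast at h3
  linarith

/-- A bound for the ratio of the logarithm in the regularization parameter to that in the regret
bound; `log (log 3)` is a lower bound for the latter, since `T ≥ 3`, `d ≥ 1` and `δ < 1`. -/
noncomputable def logRatio : ℝ := 1 + Real.log 15 / Real.log (Real.log 3)

lemma log_log_three_pos : 0 < Real.log (Real.log 3) := Real.log_pos one_lt_log_three

lemma one_le_log_fifteen : 1 ≤ Real.log 15 :=
  one_lt_log_three.le.trans (Real.log_le_log (by norm_num) (by norm_num))

lemma logRatio_pos : 0 < logRatio := by
  have := log_log_three_pos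
  have := one_le_log_fifteen
  unfold logRatio
  positivity

lemma log_threshold_bounds {d T : ℕ} {δ : ℝ} (hd : 1 ≤ d) (hT : 3 ≤ T) (hδ : 0 < δ)
    (hδ1 : δ < 1) :
    Real.log (3 / (2 * δ)) ≤ Real.log (6 * d * Real.logb 2 (2 * T) / δ) ∧
    1 ≤ Real.log (6 * d * Real.logb 2 (2 * T) / δ) ∧
    Real.log (6 * d * Real.logb 2 (2 * T) / δ) ≤
      logRatio * Real.log (d * Real.log T / δ) := by
  have hd' : (1 : ℝ) ≤ d := by exact_mod_cast hd
  have hT' : (3 : ℝ) ≤ T := by exact_mod_cast hT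
  have hlog := one_lt_log_natCast hT
  have hb := one_le_logb_two_mul hT
  have h6 : 6 ≤ 6 * (d : ℝ) * Real.logb 2 (2 * T) := by nlinarith
  have hx : Real.log 3 ≤ d * Real.log T / δ := by
    rw [le_div_iff₀ hδ]
    have h1 : Real.log 3 ≤ Real.log T := Real.log_le_log (by norm_num) hT'
    have h3 := one_lt_log_three
    nlinarith
  have hx0 : 0 < d * Real.log T / δ := lt_of_lt_of_le (by linarith [one_lt_log_three]) hx
  refine ⟨?_, ?_, ?_⟩
  · refine Real.log_le_log (by positivity) ?_
    rw [div_le_div_iff₀ (by positivity) hδ]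
    nlinarith
  · refine one_lt_log_three.le.trans (Real.log_le_log (by norm_num) ?_)
    rw [le_div_iff₀ hδ]
    linarith
  · have hle : 6 * d * Real.logb 2 (2 * T) / δ ≤ 15 * (d * Real.log T / δ) := by
      have h1 : Real.logb 2 (2 * T) ≤ 5 / 2 * Real.log T := by
        rw [Real.logb_mul (by norm_num) (by positivity), Real.logb_self_eq_one (by norm_num),
          Real.logb]
        have h2 : Real.log T / Real.log 2 ≤ 3 / 2 * Real.log T := by
          rw [div_le_iff₀ (Real.log_pos (by norm_num))]
          have := Real.log_two_gt_d9
          nlinarith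
        linarith
      rw [← mul_div_assoc]
      refine div_le_div_of_nonneg_right ?_ hδ.le
      have := mul_le_mul_of_nonneg_left h1 (by positivity : 0 ≤ 6 * (d : ℝ))
      linarith
    have h1 : Real.log (6 * d * Real.logb 2 (2 * T) / δ) ≤
        Real.log 15 + Real.log (d * Real.log T / δ) := by
      rw [← Real.log_mul (by norm_num) hx0.ne']
      refine Real.log_le_log (by positivity) hle
    have h2 : Real.log (Real.log 3) ≤ Real.log (d * Real.log T / δ) :=
      Real.log_le_log (by linarith [one_lt_log_three]) hx
    have h3 : Real.log 15 ≤ Real.log 15 / Real.log (Real.log 3) *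
        Real.log (d * Real.log T / δ) := by
      rw [div_mul_eq_mul_div, le_div_iff₀ log_log_three_pos]
      have := one_le_log_fifteen
      gcongr
    rw [logRatio]
    linarith

/-- The choice of `lam` makes the noise event have probability at most `δ / 3`: as
`4 lam ^ 2 / (9 B ^ 2) = log (6 d log₂ (2T) / δ)`, each coordinate, sign and epoch contributes
`δ / (6 d log₂ (2T))`. -/
lemma noise_failure_le {d T : ℕ} {B δ : ℝ} (hd : 1 ≤ d) (hT : 3 ≤ T) (hδ : 0 < δ) (hδ1 : δ < 1)
    (hB : 0 < B) :
    2 * d * (Nat.log 4 T + 1) * Real.exp (-(4 / 9 * lamChoice B d T δ ^ 2 / B ^ 2)) ≤ δ / 3 := by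
  have hd' : (1 : ℝ) ≤ d := by exact_mod_cast hd
  have hb := one_le_logb_two_mul hT
  have hl := (log_threshold_bounds hd hT hδ hδ1).2.1
  have hexp : 4 / 9 * lamChoice B d T δ ^ 2 / B ^ 2 =
      Real.log (6 * d * Real.logb 2 (2 * T) / δ) := by
    rw [lamChoice, mul_pow, Real.sq_sqrt (by linarith)]
    field_simp
    norm_num
  rw [hexp, Real.exp_neg, Real.exp_log (by positivity), inv_div]
  calc 2 * (d : ℝ) * (Nat.log 4 T + 1) * (δ / (6 * d * Real.logb 2 (2 * T)))
      ≤ 2 * (d : ℝ) * Real.logb 2 (2 * T) * (δ / (6 * d * Real.logb 2 (2 * T))) := by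
        gcongr
        exact natLog_four_add_one_le hT
    _ = δ / 3 := by
        field_simp
        norm_num

/-- The bounds on the linear regret and on the excess add up to the regret bound, for
`lam = 3 B / 2 * √ℓ` and `η = α / 2`. -/
lemma regret_constant_le {k : ℕ} {B α ℓ ℓ' c lT K : ℝ} (hα : 0 < α) (hlT : 1 ≤ lT) (hc : c ≤ ℓ)
    (h1 : 1 ≤ ℓ) (hℓ : ℓ ≤ K * ℓ') :
    k * ((6 * (3 * B / 2 * √ℓ) ^ 2 + 2 * B ^ 2) / (α / 2) * lT) + 16 * k * B ^ 2 / α * c ≤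
      47 * K * (k * B ^ 2 / α * ℓ' * lT) := by
  have hsq : (3 * B / 2 * √ℓ) ^ 2 = 9 / 4 * B ^ 2 * ℓ := by
    rw [mul_pow, Real.sq_sqrt (by linarith)]
    ring
  have hq : 0 ≤ k * B ^ 2 / α := by positivity
  have hlin : (27 * ℓ + 4) * lT + 16 * c ≤ 47 * (K * ℓ') * lT := by
    have h2 : c ≤ ℓ * lT := hc.trans (le_mul_of_one_le_right (by linarith) hlT)
    have h3 : lT ≤ ℓ * lT := le_mul_of_one_le_left (by linarith) h1
    have h4 : ℓ * lT ≤ K * ℓ' * lT := mul_le_mul_of_nonneg_right hℓ (by linarith)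
    linarith
  calc _ = k * B ^ 2 / α * ((27 * ℓ + 4) * lT + 16 * c) := by
        rw [hsq]
        field_simp
        ring
    _ ≤ k * B ^ 2 / α * (47 * (K * ℓ') * lT) := mul_le_mul_of_nonneg_left hlin hq
    _ = _ := by ring

end StreamingSparse

open StreamingSparse in
theorem theorem2 :
    ∃ C : ℝ, 0 < C ∧
      ∀ (Ω : Type*) [MeasurableSpace Ω] (μ : Measure Ω) [IsProbabilityMeasure μ]
        (d k T : ℕ) (f : ℕ → Ω → StreamingSparse.Vec d → ℝ)
        (L : StreamingSparse.Vec d → ℝ) (wstar : StreamingSparse.Vec d)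
        (S : Finset (Fin d)) (R B α δ : ℝ),
        3 ≤ T → 0 < δ →
        StreamingSparse.IsLossSequence T f →
        StreamingSparse.StatisticalSparsity μ T k f L wstar S R →
        StreamingSparse.StrongConvexityInExpectation L S α →
        StreamingSparse.BoundedGradients μ T f S R B →
        StreamingSparse.OrthogonalNoise μ T f S R →
        ∀ w : Ω → ℕ → StreamingSparse.Vec d,
        (∀ ω t, w ω t = StreamingSparse.weight (α / 2)
          (StreamingSparse.lamChoice B d T δ) 0 (fun s => f s ω) t) →
        μ {ω | ¬ ((∀ t ∈ Finset.Icc 1 T, StreamingSparse.l1Norm (w ω t) ≤ R) →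
            StreamingSparse.regret (fun s => f s ω) (w ω) T wstar ≤
              C * (k * B ^ 2 / α * Real.log (d * Real.log T / δ) * Real.log T))}
          ≤ ENNReal.ofReal δ := by
  classical
  refine ⟨47 * logRatio, by linarith [logRatio_pos], ?_⟩
  intro Ω _ μ _ d k T f L u S R B α δ hT hδ hf hL hconv hB hnoise w hw
  rcases le_or_gt 1 δ with hδ1 | hδ1
  · exact prob_le_one.trans (ENNReal.one_le_ofReal.2 hδ1)
  rcases Nat.eq_zero_or_pos d with rfl | hd
  · have hzero : ∀ x : Vec 0, x = u := fun x => by ext i; exact i.elim0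
    refine le_of_eq_of_le ?_ zero_le
    convert measure_empty (μ := μ) using 2
    refine Set.eq_empty_of_forall_notMem fun ω hω => hω fun _ => ?_
    simp [regret, hzero (w ω _)]
  have hα : 0 < α := hconv.1
  have hu : u ∈ candidates R S :=
    ⟨hL.l1Norm_le, fun i hi => by_contra fun h => hi ((hL.support_eq i).1 h)⟩
  have hB0 : 0 ≤ B := by
    obtain ⟨ω, hω⟩ := hB.exists
    exact (abs_nonneg _).trans (hω 1 (Finset.mem_Icc.2 ⟨le_rfl, by omega⟩) u hu ⟨0, hd⟩)
  set lam := lamChoice B d T δ with hlamdef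
  have hlam : 0 ≤ lam := by
    rw [hlamdef, lamChoice]
    positivity
  obtain ⟨hc, h1, hℓ⟩ := log_threshold_bounds hd hT hδ hδ1
  have hlT := (one_lt_log_natCast hT).le
  -- The iterates, replaced by `u` when they leave the candidate set, form a predictable sequence
  -- of candidates.
  let W : ℕ → Ω → Vec d := fun n ω => if w ω (n + 1) ∈ candidates R S then w ω (n + 1) else u
  have hWH : ∀ n ω, W n ω ∈ candidates R S := by
    intro n ω
    simp only [W]
    split_ifs with h
    exacts [h, hu]
  have hW : ∀ n < T, Measurable[past f (n + 1)] (W n) := by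
    intro n hn
    have hm : Measurable[past f (n + 1)] fun ω => w ω (n + 1) := by
      simp only [hw]
      exact measurable_weight hf (α / 2) lam 0 hn.le
    exact Measurable.ite (hm (measurableSet_candidates R S)) hm measurable_const
  let N : Set Ω := {ω | ∃ n ≤ T, ∃ i ∉ S, lam * √((n : ℝ) + 2) <
        |∑ j ∈ Finset.range n, gradient (f (j + 1) ω) (W j ω) i|}
  have hN : μ N ≤ ENNReal.ofReal (δ / 3) := by
    rcases hB0.eq_or_lt with rfl | hBpos
    · refine le_of_eq_of_le ?_ zero_le
      refine measure_mono_null_ae ?_ (measure_empty (μ := μ))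
      filter_upwards [hB] with ω hω
      rintro ⟨n, hn, i, _, hlt⟩
      have hz : ∑ j ∈ Finset.range n, gradient (f (j + 1) ω) (W j ω) i = 0 := by
        refine Finset.sum_eq_zero fun j hj => ?_
        have hj := Finset.mem_range.1 hj
        exact abs_nonpos_iff.1 (hω (j + 1) (Finset.mem_Icc.2 ⟨by omega, by omega⟩) _ (hWH j ω) i)
      rw [hz, abs_zero] at hlt
      exact absurd hlt (not_lt.2 (by positivity))
    · exact (measure_exists_noise_gt_le hf hB hnoise hW hWH hBpos hlam).trans
        (ENNReal.ofReal_le_ofReal (noise_failure_le hd hT hδ hδ1 hBpos))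
  -- Off a set of probability `2 δ / 3`, candidate iterates have small regret.
  obtain ⟨N', hN', hregret⟩ : ∃ N' : Set Ω, μ N' ≤ ENNReal.ofReal (2 * δ / 3) ∧ ∀ ω ∉ N',
      (∀ t ∈ Finset.Icc 1 T, ∀ w ∈ candidates R S, ∀ i, |gradient (f t ω) w i| ≤ B) →
      (∀ n < T, w ω (n + 1) ∈ candidates R S) →
      regret (fun s => f s ω) (w ω) T u ≤
        47 * logRatio * (k * B ^ 2 / α * Real.log (d * Real.log T / δ) * Real.log T) := by
    by_cases hkB : 0 < B ∧ 0 < k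
    · refine ⟨_, (measure_excess_gt_le hf hL hconv hB hW hWH hkB.1 hkB.2
        (Real.log (3 / (2 * δ)))).trans (le_of_eq ?_), ?_⟩
      · rw [Real.exp_neg, Real.exp_log (by positivity), inv_div]
      · intro ω hω hBω hmem
        have hWw : ∀ n < T, W n ω = w ω (n + 1) := fun n hn => if_pos (hmem n hn)
        simp only [Set.mem_ofPred_eq, not_lt] at hω
        have hlin := linear_regret_le (g := fun s => f s ω) (η := α / 2) (by positivity) hlam hT
          (fun n hn => by rw [← hw]; exact hmem n hn) hBω hu
        simp only [← hw] at hlin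
        have hcard : (S.card : ℝ) * ((6 * lam ^ 2 + 2 * B ^ 2) / (α / 2) * Real.log T) ≤
            k * ((6 * lam ^ 2 + 2 * B ^ 2) / (α / 2) * Real.log T) := by
          gcongr
          exact hL.card_le
        have hconst := regret_constant_le (k := k) (B := B) hα hlT hc h1 hℓ
        have hexc : ∑ n ∈ Finset.range T, (linearizationExcess (f (n + 1) ω) u (W n ω) +
            3 * α / 8 * ∑ i ∈ S, (W n ω i - u i) ^ 2) =
            regret (fun s => f s ω) (w ω) T u -
            ∑ n ∈ Finset.range T, ∑ i, gradient (f (n + 1) ω) (w ω (n + 1)) i *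
              (w ω (n + 1) i - u i) +
            3 * α / 8 * ∑ n ∈ Finset.range T, ∑ i ∈ S, (w ω (n + 1) i - u i) ^ 2 := by
          rw [regret_eq_sum_range, Finset.mul_sum, ← Finset.sum_sub_distrib,
            ← Finset.sum_add_distrib]
          refine Finset.sum_congr rfl fun n hn => ?_
          rw [hWw n (Finset.mem_range.1 hn), linearizationExcess]
        rw [hexc] at hω
        rw [hlamdef, lamChoice] at hcard hlin
        linarith
    · refine ⟨∅, by simp, fun ω _ hBω hmem => ?_⟩
      -- With `k = 0` or `B = 0` all losses are constant on the candidate set.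
      have hzero : regret (fun s => f s ω) (w ω) T u ≤ 0 := by
        rw [regret_eq_sum_range]
        refine Finset.sum_nonpos fun n hn => ?_
        have hn := Finset.mem_range.1 hn
        have hn' : n + 1 ∈ Finset.Icc 1 T := Finset.mem_Icc.2 ⟨by omega, hn⟩
        have h := (le_abs_self _).trans (abs_sub_le_mul_l1Norm
          ((hf.contDiff _ hn' ω).differentiable one_ne_zero) (hBω _ hn') (hmem n hn) hu)
        rcases not_and_or.1 hkB with hB' | hk
        · rwa [le_antisymm (not_lt.1 hB') hB0, zero_mul] at h
        · have hS : S = ∅ := by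
            have := hL.card_le
            exact Finset.card_eq_zero.1 (by omega)
          have : w ω (n + 1) = u := by
            ext i
            rw [(hmem n hn).2 i (by simp [hS]), hu.2 i (by simp [hS])]
          simp [this]
      refine hzero.trans ?_
      have hpos : 0 ≤ Real.log (d * Real.log T / δ) :=
        (pos_of_mul_pos_right (lt_of_lt_of_le (by linarith) hℓ) logRatio_pos.le).le
      have := logRatio_pos
      have : 0 ≤ Real.log T := by linarith
      positivity
  calc _ ≤ μ (N ∪ N') := by
        refine measure_mono_ae ?_
        filter_upwards [hB] with ω hBω hω
        by_contra hNN
        refine hω fun hl1 => ?_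
        have hωN : ω ∉ N := fun h => hNN (Or.inl h)
        refine hregret ω (fun h => hNN (Or.inr h)) hBω fun n hn => ?_
        rw [hw]
        refine weight_mem_candidates (W := fun n => W n ω)
          (fun t ht => by rw [← hw]; exact hl1 t ht) ?_ ?_ hn
        · intro n h
          rw [← hw] at h ⊢
          exact if_pos h
        · intro n hn i hi
          by_contra hlt
          exact hωN ⟨n, hn, i, hi, not_le.1 hlt⟩
    _ ≤ ENNReal.ofReal (δ / 3) + ENNReal.ofReal (2 * δ / 3) :=
        (measure_union_le _ _).trans (add_le_add hN hN')
    _ = ENNReal.ofReal δ := by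
        rw [← ENNReal.ofReal_add (by positivity) (by positivity)]
        congr 1
        ring
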